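/- Let $\omega>0$ and let $V\in L^1_{loc}(\mathbb R)$ be complex-valued and $\omega$-periodic. Let $H$ be the Hill operator in $L^2(\mathbb R)$, $Hf=-f''+Vf$, with domain $\{g\in L^2(\mathbb R): g,g'\in AC_{loc}(\mathbb R),\ -g''+Vg\in L^2(\mathbb R)\}$, and let $\sigma(H)$ be its spectrum. For $E\in\mathbb C$ let $\phi_1(E,\cdot),\phi_2(E,\cdot)$ be the solutions of $-\psi''+V\psi=E\psi$ with $\phi_1(E,0)=\phi_2'(E,0)=1$ and $\phi_1'(E,0)=\phi_2(E,0)=0$, and let $\Delta(E)=\frac12\big(\phi_1(E,\omega)+\phi_2'(E,\omega)\big)$ be the Floquet discriminant. An analytic arc is the image of a compact interval under an injective map into $\mathbb C$ that is real-analytic on a neighbourhood of the interval and has non-vanishing derivative on it. The statements below on $\sigma(H)$ near $E_0$ mean that the set $\sigma(H)\cap U$, for some open neighbourhood $U$ of $E_0$, has the described form (the arcs being taken without those of their end points that are different from $E_0$). Let $E_0\in\mathbb C$. Suppose that $\Delta'(E_0)\neq0$. (i) If $\Delta(E_0)$ is real and $-1<\Delta(E_0)<1$, then near $E_0$ the spectrum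 $\sigma(H)$ is a single analytic arc with $E_0$ in its interior. (ii) If $\Delta(E_0)=\pm1$, then near $E_0$ the spectrum is a single analytic arc, one of whose end points is $E_0$. Suppose instead that, for some integer $k\ge2$, $\Delta'(E_0)=\Delta''(E_0)=\dots=\Delta^{(k-1)}(E_0)=0$ and $\Delta^{(k)}(E_0)\neq0$. (iii) If $\Delta(E_0)$ is real and $-1<\Delta(E_0)<1$, then near $E_0$ the spectrum consists of $2k$ analytic arcs that have the common end point $E_0$ and pairwise no other common point; adjacent arcs meet at $E_0$ at an angle of $\pi/k$. (iv) If $\Delta(E_0)=\pm1$, then near $E_0$ the spectrum consists of $k$ analytic arcs that have the common end point $E_0$ and pairwise no other common point; adjacent arcs meet at $E_0$ at an angle of $2\pi/k$. -/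

import Mathlib

open MeasureTheory Set Filter Topology

noncomputable section

namespace Hill

/-- `f` is locally absolutely continuous on `ℝ`: absolutely continuous on every compact interval. -/
def ACLoc (f : ℝ → ℂ) : Prop := ∀ a b : ℝ, AbsolutelyContinuousOnInterval f a b

/-- `g` and its derivative `g'` are locally absolutely continuous
(in particular `g` is differentiable at every point). -/
structure ACLocTwo (g : ℝ → ℂ) : Prop where
  differentiable : Differentiable ℝ g
  acLoc : ACLoc g
  acLoc_deriv : ACLoc (deriv g)

/-- The differential expression `-g'' + V g`. The second derivative of a function with
locally absolutely continuous derivative exists almost everywhere. -/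
def diffExpr (V g : ℝ → ℂ) (x : ℝ) : ℂ := -deriv (deriv g) x + V x * g x

/-- `ψ` solves `-ψ'' + V ψ = E ψ` on `ℝ` (in the Carathéodory sense). -/
structure IsSolution (V : ℝ → ℂ) (E : ℂ) (ψ : ℝ → ℂ) : Prop where
  acLocTwo : ACLocTwo ψ
  eqn : ∀ᵐ x : ℝ, diffExpr V ψ x = E * ψ x

/-- The solution of `-ψ'' + V ψ = E ψ` with `ψ 0 = a` and `ψ' 0 = b`
(it exists and is unique when `V` is locally integrable). -/
def solution (V : ℝ → ℂ) (E a b : ℂ) : ℝ → ℂ :=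
  Classical.epsilon fun ψ : ℝ → ℂ => IsSolution V E ψ ∧ ψ 0 = a ∧ deriv ψ 0 = b

/-- The fundamental solution `φ₁(E, ·)`. -/
def phi₁ (V : ℝ → ℂ) (E : ℂ) : ℝ → ℂ := solution V E 1 0

/-- The fundamental solution `φ₂(E, ·)`. -/
def phi₂ (V : ℝ → ℂ) (E : ℂ) : ℝ → ℂ := solution V E 0 1

/-- The monodromy matrix `M(E)`. -/
def monodromy (V : ℝ → ℂ) (ω : ℝ) (E : ℂ) : Matrix (Fin 2) (Fin 2) ℂ :=
  !![phi₁ V E ω, phi₂ V E ω; deriv (phi₁ V E) ω, deriv (phi₂ V E) ω]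

/-- The Floquet discriminant `Δ(E)`: half of the trace of the monodromy matrix. -/
def discriminant (V : ℝ → ℂ) (ω : ℝ) (E : ℂ) : ℂ := (monodromy V ω E).trace / 2

/-- The Hilbert space `L²(ℝ)` of complex-valued functions. -/
abbrev L2 : Type := Lp ℂ 2 (volume : Measure ℝ)

/-- `g` is the regular representative of a class `f` in the domain of the Hill operator. -/
structure IsDomRep (V : ℝ → ℂ) (f : L2) (g : ℝ → ℂ) : Prop where
  ae_eq : f =ᵐ[volume] g
  acLocTwo : ACLocTwo g
  memLp : MemLp (diffExpr V g) 2 volume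

theorem ACLoc.ae_differentiableAt {f : ℝ → ℂ} (hf : ACLoc f) :
    ∀ᵐ x : ℝ, DifferentiableAt ℝ f x := by
  have h : LocallyBoundedVariationOn f univ := by
    intro a b _ _
    exact (hf a b).boundedVariationOn.mono (fun x hx => Icc_subset_uIcc hx.2)
  exact h.ae_differentiableAt

theorem ACLoc.add {f g : ℝ → ℂ} (hf : ACLoc f) (hg : ACLoc g) : ACLoc (f + g) :=
  fun a b => (hf a b).add (hg a b)

theorem ACLoc.smul {f : ℝ → ℂ} (c : ℂ) (hf : ACLoc f) : ACLoc (c • f) :=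
  fun a b => (hf a b).const_smul c

theorem ACLocTwo.deriv_add {f g : ℝ → ℂ} (hf : ACLocTwo f) (hg : ACLocTwo g) :
    deriv (f + g) = deriv f + deriv g :=
  funext fun x => _root_.deriv_add (hf.differentiable x) (hg.differentiable x)

theorem ACLocTwo.deriv_smul {f : ℝ → ℂ} (c : ℂ) (hf : ACLocTwo f) :
    deriv (c • f) = c • deriv f :=
  funext fun x => deriv_const_smul c (hf.differentiable x)

theorem ACLocTwo.add {f g : ℝ → ℂ} (hf : ACLocTwo f) (hg : ACLocTwo g) : ACLocTwo (f + g) where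
  differentiable := hf.differentiable.add hg.differentiable
  acLoc := hf.acLoc.add hg.acLoc
  acLoc_deriv := by rw [hf.deriv_add hg]; exact hf.acLoc_deriv.add hg.acLoc_deriv

theorem ACLocTwo.smul {f : ℝ → ℂ} (c : ℂ) (hf : ACLocTwo f) : ACLocTwo (c • f) where
  differentiable := hf.differentiable.const_smul c
  acLoc := hf.acLoc.smul c
  acLoc_deriv := by rw [hf.deriv_smul c]; exact hf.acLoc_deriv.smul c

theorem ACLocTwo.diffExpr_add (V : ℝ → ℂ) {f g : ℝ → ℂ} (hf : ACLocTwo f) (hg : ACLocTwo g) :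
    diffExpr V (f + g) =ᵐ[volume] diffExpr V f + diffExpr V g := by
  filter_upwards [hf.acLoc_deriv.ae_differentiableAt, hg.acLoc_deriv.ae_differentiableAt]
    with x h1 h2
  simp only [diffExpr, hf.deriv_add hg, Pi.add_apply, _root_.deriv_add h1 h2]
  ring

theorem ACLocTwo.diffExpr_smul (V : ℝ → ℂ) {f : ℝ → ℂ} (c : ℂ) (hf : ACLocTwo f) :
    diffExpr V (c • f) =ᵐ[volume] c • diffExpr V f := by
  filter_upwards [hf.acLoc_deriv.ae_differentiableAt] with x h1
  simp only [diffExpr, hf.deriv_smul c, Pi.smul_apply, smul_eq_mul, deriv_const_smul c h1]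
  ring

theorem IsDomRep.add {V : ℝ → ℂ} {f₁ f₂ : L2} {g₁ g₂ : ℝ → ℂ}
    (h₁ : IsDomRep V f₁ g₁) (h₂ : IsDomRep V f₂ g₂) : IsDomRep V (f₁ + f₂) (g₁ + g₂) where
  ae_eq := (Lp.coeFn_add f₁ f₂).trans (h₁.ae_eq.add h₂.ae_eq)
  acLocTwo := h₁.acLocTwo.add h₂.acLocTwo
  memLp := (memLp_congr_ae (h₁.acLocTwo.diffExpr_add V h₂.acLocTwo)).2 (h₁.memLp.add h₂.memLp)

theorem IsDomRep.smul {V : ℝ → ℂ} (c : ℂ) {f : L2} {g : ℝ → ℂ}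
    (h : IsDomRep V f g) : IsDomRep V (c • f) (c • g) where
  ae_eq := (Lp.coeFn_smul c f).trans (h.ae_eq.const_smul c)
  acLocTwo := h.acLocTwo.smul c
  memLp := (memLp_congr_ae (h.acLocTwo.diffExpr_smul V c)).2 (h.memLp.const_smul c)

theorem isDomRep_zero (V : ℝ → ℂ) : IsDomRep V 0 0 where
  ae_eq := Lp.coeFn_zero ℂ 2 volume
  acLocTwo :=
    { differentiable := differentiable_const 0
      acLoc := fun a b => (contDiff_const (c := (0 : ℂ))).contDiffOn.absolutelyContinuousOnInterval
      acLoc_deriv := fun a b => by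
        have : deriv (0 : ℝ → ℂ) = fun _ => 0 := funext fun x => by simp
        rw [this]
        exact (contDiff_const (c := (0 : ℂ))).contDiffOn.absolutelyContinuousOnInterval }
  memLp := by
    have : diffExpr V 0 = 0 := by
      have h : deriv (0 : ℝ → ℂ) = 0 := funext fun x => by simp
      funext x
      simp [diffExpr, h]
    rw [this]
    exact MemLp.zero

theorem IsDomRep.unique {V : ℝ → ℂ} {f : L2} {g₁ g₂ : ℝ → ℂ}
    (h₁ : IsDomRep V f g₁) (h₂ : IsDomRep V f g₂) : g₁ = g₂ :=
  (h₁.acLocTwo.differentiable.continuous.ae_eq_iff_eq volume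
    h₂.acLocTwo.differentiable.continuous).1 (h₁.ae_eq.symm.trans h₂.ae_eq)

/-- `dom(H)`: the classes in `L²(ℝ)` of functions `g` such that `g` and `g'` are locally absolutely
continuous and `-g'' + V g ∈ L²(ℝ)`. -/
def hillDomain (V : ℝ → ℂ) : Submodule ℂ L2 where
  carrier := {f | ∃ g, IsDomRep V f g}
  add_mem' := fun ⟨g₁, h₁⟩ ⟨g₂, h₂⟩ => ⟨g₁ + g₂, h₁.add h₂⟩
  zero_mem' := ⟨0, isDomRep_zero V⟩
  smul_mem' := fun c _ ⟨g, h⟩ => ⟨c • g, h.smul c⟩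

/-- The regular representative of an element of `dom(H)`. -/
def domRep (V : ℝ → ℂ) (f : hillDomain V) : ℝ → ℂ := Classical.choose f.2

theorem isDomRep_domRep (V : ℝ → ℂ) (f : hillDomain V) : IsDomRep V f (domRep V f) :=
  Classical.choose_spec f.2

/-- The Hill operator `H f = -f'' + V f` in `L²(ℝ)`, with domain `hillDomain V`. -/
def hillOperator (V : ℝ → ℂ) : L2 →ₗ.[ℂ] L2 where
  domain := hillDomain V
  toFun :=
    { toFun := fun f => (isDomRep_domRep V f).memLp.toLp
      map_add' := fun f₁ f₂ => by
        have h₁ := isDomRep_domRep V f₁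
        have h₂ := isDomRep_domRep V f₂
        have e : domRep V (f₁ + f₂) = domRep V f₁ + domRep V f₂ :=
          (isDomRep_domRep V (f₁ + f₂)).unique (h₁.add h₂)
        rw [← MemLp.toLp_add, MemLp.toLp_eq_toLp_iff, e]
        exact h₁.acLocTwo.diffExpr_add V h₂.acLocTwo
      map_smul' := fun c f => by
        have h := isDomRep_domRep V f
        have e : domRep V (c • f) = c • domRep V f :=
          (isDomRep_domRep V (c • f)).unique (h.smul c)
        rw [RingHom.id_apply, ← MemLp.toLp_const_smul, MemLp.toLp_eq_toLp_iff, e]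
        exact h.acLocTwo.diffExpr_smul V c }

/-- The resolvent set of an (unbounded) operator `T`: those `z` for which `T - z` is a bijection
from the domain of `T` onto the whole space with an everywhere defined bounded inverse `R`. -/
def resolventSet {X : Type*} [NormedAddCommGroup X] [NormedSpace ℂ X] (T : X →ₗ.[ℂ] X) : Set ℂ :=
  {z | ∃ R : X →L[ℂ] X,
    (∀ y : X, ∃ h : R y ∈ T.domain, T ⟨R y, h⟩ - z • R y = y) ∧
    ∀ x : T.domain, R (T x - z • (x : X)) = x}

/-- The spectrum of an (unbounded) operator: the complement of its resolvent set. -/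
def spectrumSet {X : Type*} [NormedAddCommGroup X] [NormedSpace ℂ X] (T : X →ₗ.[ℂ] X) : Set ℂ :=
  (resolventSet T)ᶜ

/-- `γ` restricted to `[a, b]` parametrizes a (compact) analytic arc: it is real-analytic on a
neighbourhood of `[a, b]`, injective on `[a, b]`, and its derivative does not vanish there. -/
structure IsAnalyticArc (γ : ℝ → ℂ) (a b : ℝ) : Prop where
  analytic : AnalyticOnNhd ℝ γ (Icc a b)
  injOn : InjOn γ (Icc a b)
  deriv_ne_zero : ∀ t ∈ Icc a b, deriv γ t ≠ 0

/-- Near `E₀` the set `S` is one analytic arc, with `E₀` in its interior. -/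
def IsArcThrough (S : Set ℂ) (E₀ : ℂ) : Prop :=
  ∃ γ : ℝ → ℂ, IsAnalyticArc γ (-1) 1 ∧ γ 0 = E₀ ∧
    ∃ U : Set ℂ, IsOpen U ∧ E₀ ∈ U ∧ S ∩ U = γ '' Ioo (-1) 1

/-- Near `E₀` the set `S` is one analytic arc, with `E₀` as one of its end points. -/
def IsArcFrom (S : Set ℂ) (E₀ : ℂ) : Prop :=
  ∃ γ : ℝ → ℂ, IsAnalyticArc γ 0 1 ∧ γ 0 = E₀ ∧
    ∃ U : Set ℂ, IsOpen U ∧ E₀ ∈ U ∧ S ∩ U = γ '' Ico 0 1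

/-- Near `E₀` the set `S` consists of `n` analytic arcs with the common end point `E₀`, which have
no other point in common; in counterclockwise order, the direction of each arc at `E₀` is
obtained from that of the preceding one by a rotation through the angle `α`. -/
def IsArcStar (S : Set ℂ) (E₀ : ℂ) (n : ℕ) (α : ℝ) : Prop :=
  ∃ γ : Fin n → ℝ → ℂ,
    (∀ j, IsAnalyticArc (γ j) 0 1 ∧ γ j 0 = E₀) ∧
    (∀ i j, i ≠ j → γ i '' Icc 0 1 ∩ γ j '' Icc 0 1 = {E₀}) ∧
    (∃ U : Set ℂ, IsOpen U ∧ E₀ ∈ U ∧ S ∩ U = ⋃ j, γ j '' Ico 0 1) ∧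
    ∃ θ : ℝ, ∀ j : Fin n, deriv (γ j) 0 =
      ‖deriv (γ j) 0‖ * Complex.exp (((θ + (j : ℕ) * α : ℝ) : ℂ) * Complex.I)

end Hill

end

/-!
Floquet theory reduces the statement to complex analysis: the spectrum of `H` is the set of `E` with
`Δ(E) ∈ [-1, 1]` (`mem_spectrumSet_iff`), and `Δ` is entire (`differentiable_discriminant`). If `k`
is the order of the first nonvanishing derivative of `Δ` at `E₀`, there is a holomorphic chart `ζ`
at `E₀` with `Δ (ζ w) = Δ(E₀) + w ^ k` (`exists_isHolomorphicChart_pow`). In this chart the spectrum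
is the set where `w ^ k` is real, if `-1 < Δ(E₀) < 1`, and the set where `∓ w ^ k ≥ 0`, if
`Δ(E₀) = ±1`. The first condition reads `w ^ (2 k) ≥ 0`, so that in both cases the spectrum is the
image of a set `c w ^ n ≥ 0`, which consists of `n` equidistributed rays
(`IsHolomorphicChart.isArcStar`); a chart preserves angles.

Existence of solutions and their holomorphic dependence on `E` come from one application of the
Neumann series: in the weighted supremum norm with weight `exp (2 |∫₀ˣ a|)`, where
`a = 1 + R + |V|`, the Volterra operators of the first order system are contractions on the whole
line, uniformly for `|E| < R`, and they are affine in `E` (`exists_holomorphic_solution`).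
Uniqueness follows from the constancy of Wronskians.

The multipliers of the equation are the roots of `ρ² - 2 Δ(E) ρ + 1`, and `Δ(E) ∈ [-1, 1]` means
that they are unimodular. A Floquet solution with multiplier `ρ` grows like `|ρ| ^ (x / ω)`.

* If the multipliers are unimodular, there is a bounded solution `ψ`, and `H - E` is not onto: if
  `(H - E) f = g` with `g = conj ψ` on a period and `0` elsewhere, the Wronskian of `f` and `ψ`
  jumps by `∫ |ψ|²` across the period, whereas on each side it is constant and hence, as
  `f ∈ L²`, zero (`wronskian_eq_zero_Ici`).
* Otherwise there are solutions that decay exponentially at `+∞` and at `-∞`. The Green function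
  built from them is dominated by `exp (-κ |x - t|)`, so it defines a bounded operator on `L²` by
  Young's inequality, a right inverse of `H - E`. It is also a left inverse since `H - E` is
  injective, again because the Wronskians of an `L²` solution vanish.
-/

noncomputable section

namespace Hill

/-! ### Locally absolutely continuous functions and their derivatives -/

theorem _root_.AbsolutelyContinuousOnInterval.lipschitzOnWith_comp {X Y : Type*}
    [PseudoMetricSpace X] [PseudoMetricSpace Y] {f : ℝ → X} {g : X → Y} {s : Set X} {K : NNReal}
    {a b : ℝ} (hg : LipschitzOnWith K g s) (hf : AbsolutelyContinuousOnInterval f a b)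
    (hs : MapsTo f (uIcc a b) s) : AbsolutelyContinuousOnInterval (g ∘ f) a b := by
  rw [absolutelyContinuousOnInterval_iff] at hf ⊢
  intro ε hε
  obtain ⟨δ, hδ, h⟩ := hf (ε / (K + 1)) (by positivity)
  refine ⟨δ, hδ, fun E hE hEδ => ?_⟩
  have h1 := h E hE hEδ
  rw [lt_div_iff₀ (by positivity)] at h1
  refine lt_of_le_of_lt ?_ h1
  rw [Finset.sum_mul]
  refine Finset.sum_le_sum fun i hi => ?_
  have h2 := hE.1 i hi
  have h3 := hg.dist_le_mul _ (hs h2.1) _ (hs h2.2)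
  have : (0 : ℝ) ≤ dist (f (E.2 i).1) (f (E.2 i).2) := dist_nonneg
  simp only [Function.comp]
  nlinarith

theorem _root_.AbsolutelyContinuousOnInterval.contDiff_comp {f : ℝ → ℝ} {g : ℝ → ℝ} {a b : ℝ}
    (hg : ContDiff ℝ 1 g) (hf : AbsolutelyContinuousOnInterval f a b) :
    AbsolutelyContinuousOnInterval (g ∘ f) a b := by
  obtain ⟨C, hC⟩ := hf.exists_bound
  obtain ⟨K, hK⟩ := (hg.contDiffOn (s := Icc (-C) C)).exists_lipschitzOnWith (by decide)
    (convex_Icc _ _) isCompact_Icc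
  exact hf.lipschitzOnWith_comp hK fun x hx => abs_le.1 (hC x hx)

theorem ACLoc.re {f : ℝ → ℂ} (hf : ACLoc f) (a b : ℝ) :
    AbsolutelyContinuousOnInterval (fun x => (f x).re) a b :=
  (hf a b).lipschitzOnWith_comp (g := Complex.re) (s := univ)
    ((Complex.reCLM.lipschitz).lipschitzOnWith) (mapsTo_univ _ _)

theorem ACLoc.im {f : ℝ → ℂ} (hf : ACLoc f) (a b : ℝ) :
    AbsolutelyContinuousOnInterval (fun x => (f x).im) a b :=
  (hf a b).lipschitzOnWith_comp (g := Complex.im) (s := univ)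
    ((Complex.imCLM.lipschitz).lipschitzOnWith) (mapsTo_univ _ _)

theorem acLoc_const (c : ℂ) : ACLoc fun _ => c :=
  fun _ _ => (contDiff_const (c := c)).contDiffOn.absolutelyContinuousOnInterval

theorem acLoc_of_re_im {f : ℝ → ℂ}
    (hr : ∀ a b, AbsolutelyContinuousOnInterval (fun x => (f x).re) a b)
    (hi : ∀ a b, AbsolutelyContinuousOnInterval (fun x => (f x).im) a b) : ACLoc f := by
  intro a b
  have h := ((hr a b).smul (acLoc_const 1 a b)).add ((hi a b).smul (acLoc_const Complex.I a b))
  have e : ((fun x => (f x).re) • fun _ => (1 : ℂ)) + (fun x => (f x).im) • (fun _ => Complex.I)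
      = f := by
    funext x
    simp [Complex.re_add_im]
  rwa [e] at h

theorem _root_.MeasureTheory.LocallyIntegrable.intervalIntegrable_real {f : ℝ → ℂ}
    (hf : LocallyIntegrable f) (a b : ℝ) : IntervalIntegrable f volume a b :=
  intervalIntegrable_iff.mpr
    ((hf.integrableOn_isCompact isCompact_uIcc).mono_set uIoc_subset_uIcc)

theorem locallyIntegrable_of_intervalIntegrable {f : ℝ → ℂ}
    (hf : ∀ a b : ℝ, IntervalIntegrable f volume a b) : LocallyIntegrable f := by
  intro x
  refine ⟨Ioc (x - 1) (x + 1), Ioc_mem_nhds (by linarith) (by linarith), ?_⟩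
  exact (intervalIntegrable_iff_integrableOn_Ioc_of_le (by linarith)).1 (hf (x - 1) (x + 1))

/-- `f` is locally absolutely continuous with almost everywhere derivative `f'`; equivalently,
`f'` is locally integrable and `f` is an indefinite integral of it. -/
structure HasACDeriv (f f' : ℝ → ℂ) : Prop where
  acLoc : ACLoc f
  ae_hasDerivAt : ∀ᵐ x : ℝ, HasDerivAt f (f' x) x

theorem ACLoc.continuous {f : ℝ → ℂ} (hf : ACLoc f) : Continuous f := by
  rw [continuous_iff_continuousAt]
  intro x
  have h := (hf (x - 1) (x + 1)).continuousOn
  rw [uIcc_of_le (by linarith)] at h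
  exact h.continuousAt (Icc_mem_nhds (by linarith) (by linarith))

theorem acLoc_integral {f : ℝ → ℂ} (hf : LocallyIntegrable f) (c : ℝ) :
    ACLoc fun x => ∫ t in c..x, f t := by
  have hint := hf.intervalIntegrable_real
  have key : ∀ g : ℝ → ℝ, (∀ a b, IntervalIntegrable g volume a b) →
      ∀ a b, AbsolutelyContinuousOnInterval (fun x => ∫ t in c..x, g t) a b := by
    intro g hg a b
    refine ((hg (min c (min a b)) (max c (max a b))).absolutelyContinuousOnInterval_intervalIntegral
      (c := c) ?_).mono ?_
    · rw [uIcc_of_le (by simp)]; simp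
    · rw [uIcc_of_le (a := min c (min a b)) (by simp)]
      intro x hx
      simp only [uIcc, mem_Icc] at hx ⊢
      exact ⟨(min_le_right _ _).trans hx.1, hx.2.trans (le_max_right _ _)⟩
  refine acLoc_of_re_im ?_ ?_
  · have h := key (fun t => (f t).re) fun a b => ⟨(hint a b).1.re, (hint a b).2.re⟩
    convert h using 4 with a b x
    exact (Complex.reCLM.intervalIntegral_comp_comm (hint c x)).symm
  · have h := key (fun t => (f t).im) fun a b => ⟨(hint a b).1.im, (hint a b).2.im⟩
    convert h using 4 with a b x
    exact (Complex.imCLM.intervalIntegral_comp_comm (hint c x)).symm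

theorem hasACDeriv_integral {f : ℝ → ℂ} (hf : LocallyIntegrable f) (c : ℝ) :
    HasACDeriv (fun x => ∫ t in c..x, f t) f where
  acLoc := acLoc_integral hf c
  ae_hasDerivAt := by
    filter_upwards [_root_.LocallyIntegrable.ae_hasDerivAt_integral hf] with x hx using hx c

theorem hasACDeriv_const (c : ℂ) : HasACDeriv (fun _ => c) (fun _ => 0) where
  acLoc := acLoc_const c
  ae_hasDerivAt := Eventually.of_forall fun x => hasDerivAt_const x c

theorem ACLoc.hasACDeriv {f : ℝ → ℂ} (hf : ACLoc f) : HasACDeriv f (deriv f) where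
  acLoc := hf
  ae_hasDerivAt := by filter_upwards [hf.ae_differentiableAt] with x hx using hx.hasDerivAt

namespace HasACDeriv

variable {f f' g g' : ℝ → ℂ}

theorem congr_ae (hf : HasACDeriv f f') (h : f' =ᵐ[volume] g') : HasACDeriv f g' where
  acLoc := hf.acLoc
  ae_hasDerivAt := by
    filter_upwards [hf.ae_hasDerivAt, h] with x hx h; rwa [← h]

theorem deriv_ae_eq (hf : HasACDeriv f f') : deriv f =ᵐ[volume] f' := by
  filter_upwards [hf.ae_hasDerivAt] with x hx using hx.deriv

theorem add (hf : HasACDeriv f f') (hg : HasACDeriv g g') :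
    HasACDeriv (fun x => f x + g x) (fun x => f' x + g' x) where
  acLoc := hf.acLoc.add hg.acLoc
  ae_hasDerivAt := by
    filter_upwards [hf.ae_hasDerivAt, hg.ae_hasDerivAt] with x h1 h2 using h1.add h2

theorem mul (hf : HasACDeriv f f') (hg : HasACDeriv g g') :
    HasACDeriv (fun x => f x * g x) (fun x => f' x * g x + f x * g' x) where
  acLoc := fun a b => (hf.acLoc a b).smul (hg.acLoc a b)
  ae_hasDerivAt := by
    filter_upwards [hf.ae_hasDerivAt, hg.ae_hasDerivAt] with x h1 h2 using h1.mul h2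

theorem const_mul (c : ℂ) (hf : HasACDeriv f f') :
    HasACDeriv (fun x => c * f x) (fun x => c * f' x) where
  acLoc := hf.acLoc.smul c
  ae_hasDerivAt := by
    filter_upwards [hf.ae_hasDerivAt] with x h1 using h1.const_mul c

theorem sub (hf : HasACDeriv f f') (hg : HasACDeriv g g') :
    HasACDeriv (fun x => f x - g x) (fun x => f' x - g' x) := by
  simpa [sub_eq_add_neg] using hf.add (hg.const_mul (-1))

theorem comp_add_const (hf : HasACDeriv f f') (c : ℝ) :
    HasACDeriv (fun x => f (x + c)) (fun x => f' (x + c)) where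
  acLoc := by
    intro a b
    have h := hf.acLoc (a + c) (b + c)
    rw [absolutelyContinuousOnInterval_iff] at h ⊢
    intro ε hε
    obtain ⟨δ, hδ, h⟩ := h ε hε
    refine ⟨δ, hδ, fun E hE hEδ => ?_⟩
    refine h (E.1, fun i => ((E.2 i).1 + c, (E.2 i).2 + c)) ⟨fun i hi => ?_, ?_⟩
      (by simpa using hEδ)
    · have := hE.1 i hi
      simp only [mem_uIcc] at this ⊢
      constructor
      · rcases this.1 with h | h <;> [left; right] <;> constructor <;> linarith
      · rcases this.2 with h | h <;> [left; right] <;> constructor <;> linarith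
    · intro i hi j hj hij
      have := hE.2 hi hj hij
      simp only [Function.onFun] at this ⊢
      rw [Set.disjoint_left] at this ⊢
      intro x hx hx'
      refine this (a := x - c) ?_ ?_
      · simp only [mem_uIoc] at hx ⊢
        rcases hx with h | h <;> [left; right] <;> constructor <;> linarith
      · simp only [mem_uIoc] at hx' ⊢
        rcases hx' with h | h <;> [left; right] <;> constructor <;> linarith
  ae_hasDerivAt := by
    have := (measurePreserving_add_right (volume : Measure ℝ) c).quasiMeasurePreserving.ae
      hf.ae_hasDerivAt
    filter_upwards [this] with x hx using hx.comp_add_const x c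

theorem locallyIntegrable (hf : HasACDeriv f f') : LocallyIntegrable f' := by
  refine locallyIntegrable_of_intervalIntegrable fun a b => ?_
  have h1 := (hf.acLoc.re a b).intervalIntegrable_deriv
  have h2 := (hf.acLoc.im a b).intervalIntegrable_deriv
  have h3 : IntervalIntegrable (fun x => ((deriv (fun x => (f x).re) x : ℝ) : ℂ)
      + ((deriv (fun x => (f x).im) x : ℝ) : ℂ) * Complex.I) volume a b :=
    IntervalIntegrable.add ⟨h1.1.ofReal, h1.2.ofReal⟩
      (IntervalIntegrable.mul_const ⟨h2.1.ofReal, h2.2.ofReal⟩ _)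
  refine h3.congr_ae (ae_restrict_of_ae ?_)
  filter_upwards [hf.ae_hasDerivAt] with x hx
  have hr : HasDerivAt (fun x => (f x).re) (f' x).re x :=
    Complex.reCLM.hasFDerivAt.comp_hasDerivAt x hx
  have hi : HasDerivAt (fun x => (f x).im) (f' x).im x :=
    Complex.imCLM.hasFDerivAt.comp_hasDerivAt x hx
  rw [hr.deriv, hi.deriv, Complex.re_add_im]

theorem integral_eq_sub (hf : HasACDeriv f f') (a b : ℝ) :
    ∫ t in a..b, f' t = f b - f a := by
  have h := hf.sub (hasACDeriv_integral hf.locallyIntegrable a)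
  obtain ⟨C, hC⟩ := (h.acLoc a b).const_of_ae_hasDerivAt_zero (by
    filter_upwards [h.ae_hasDerivAt] with x hx _
    simpa using hx)
  have h1 := hC a left_mem_uIcc
  have h2 := hC b right_mem_uIcc
  simp only [intervalIntegral.integral_same, sub_zero] at h1
  rw [← h1] at h2
  linear_combination -h2

end HasACDeriv

/-- A continuous almost everywhere derivative of a locally absolutely continuous function is its
derivative at every point. -/
theorem HasACDeriv.hasDerivAt {f f' : ℝ → ℂ} (hf : HasACDeriv f f') (hc : Continuous f') (x : ℝ) :
    HasDerivAt f (f' x) x := by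
  have h : f = fun x => f 0 + ∫ t in (0 : ℝ)..x, f' t := by
    funext x; rw [hf.integral_eq_sub]; ring
  rw [h]
  exact (intervalIntegral.integral_hasDerivAt_right (hc.intervalIntegrable _ _)
    (hc.stronglyMeasurableAtFilter _ _) hc.continuousAt).const_add _

theorem acLoc_of_continuous_deriv {f : ℝ → ℂ} (hf : Differentiable ℝ f)
    (hc : Continuous (deriv f)) : ACLoc f :=
  fun _ _ => (contDiff_one_iff_deriv.2 ⟨hf, hc⟩).contDiffOn.absolutelyContinuousOnInterval

/-! ### Solutions of the differential equation and Wronskians -/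

theorem ACLocTwo.continuous_deriv {g : ℝ → ℂ} (hg : ACLocTwo g) : Continuous (deriv g) :=
  hg.acLoc_deriv.continuous

theorem ACLocTwo.hasACDeriv {g : ℝ → ℂ} (hg : ACLocTwo g) : HasACDeriv g (deriv g) :=
  hg.acLoc.hasACDeriv

theorem acLocTwo_of_hasACDeriv {g g' g'' : ℝ → ℂ} (hg : ∀ x, HasDerivAt g (g' x) x)
    (hg' : HasACDeriv g' g'') : ACLocTwo g := by
  have h1 : deriv g = g' := funext fun x => (hg x).deriv
  have h2 : Differentiable ℝ g := fun x => (hg x).differentiableAt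
  exact ⟨h2, acLoc_of_continuous_deriv h2 (h1 ▸ hg'.acLoc.continuous), h1 ▸ hg'.acLoc⟩

theorem isSolution_of_hasACDeriv {V : ℝ → ℂ} {E : ℂ} {ψ ψ' : ℝ → ℂ}
    (h : ∀ x, HasDerivAt ψ (ψ' x) x) (h' : HasACDeriv ψ' fun x => (V x - E) * ψ x) :
    IsSolution V E ψ where
  acLocTwo := acLocTwo_of_hasACDeriv h h'
  eqn := by
    have h1 : deriv ψ = ψ' := funext fun x => (h x).deriv
    filter_upwards [h'.deriv_ae_eq] with x hx
    rw [diffExpr, h1, hx]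
    ring

theorem ACLocTwo.hasACDeriv_deriv {V g r : ℝ → ℂ} {E : ℂ} (hg : ACLocTwo g)
    (h : ∀ᵐ x, diffExpr V g x - E * g x = r x) :
    HasACDeriv (deriv g) fun x => (V x - E) * g x - r x := by
  refine hg.acLoc_deriv.hasACDeriv.congr_ae ?_
  filter_upwards [h] with x hx
  rw [diffExpr] at hx
  linear_combination -hx

theorem IsSolution.hasACDeriv_deriv {V ψ : ℝ → ℂ} {E : ℂ} (h : IsSolution V E ψ) :
    HasACDeriv (deriv ψ) fun x => (V x - E) * ψ x := by
  have := h.acLocTwo.hasACDeriv_deriv (r := 0) (V := V) (E := E) (by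
    filter_upwards [h.eqn] with x hx
    simp [hx])
  simpa using this

/-- The Wronskian `f g' - f' g`. -/
def wronskian (f g : ℝ → ℂ) (x : ℝ) : ℂ := f x * deriv g x - deriv f x * g x

theorem hasACDeriv_wronskian {f g f'' g'' : ℝ → ℂ} (hf : ACLocTwo f) (hg : ACLocTwo g)
    (hf' : HasACDeriv (deriv f) f'') (hg' : HasACDeriv (deriv g) g'') :
    HasACDeriv (wronskian f g) fun x => f x * g'' x - f'' x * g x := by
  have h := (hf.hasACDeriv.mul hg').sub (hf'.mul hg.hasACDeriv)
  refine h.congr_ae (Eventually.of_forall fun x => ?_)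
  simp only
  ring

/-- Lagrange's identity: if `-g'' + V g - E g = r` and `ψ` solves the homogeneous equation, then
the Wronskian of `g` and `ψ` is an indefinite integral of `r ψ`. -/
theorem wronskian_sub {V g ψ r : ℝ → ℂ} {E : ℂ} (hg : ACLocTwo g)
    (h : ∀ᵐ x, diffExpr V g x - E * g x = r x) (hψ : IsSolution V E ψ) (x y : ℝ) :
    wronskian g ψ y - wronskian g ψ x = ∫ t in x..y, r t * ψ t := by
  rw [← (hasACDeriv_wronskian hg hψ.acLocTwo (hg.hasACDeriv_deriv h)
    hψ.hasACDeriv_deriv).integral_eq_sub x y]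
  refine intervalIntegral.integral_congr fun t _ => ?_
  ring

theorem IsSolution.wronskian_eq {V f ψ : ℝ → ℂ} {E : ℂ} (hf : IsSolution V E f)
    (hψ : IsSolution V E ψ) (x y : ℝ) : wronskian f ψ x = wronskian f ψ y := by
  have h := wronskian_sub (r := 0) hf.acLocTwo (by
    filter_upwards [hf.eqn] with x hx
    simp [hx]) hψ y x
  simpa [sub_eq_zero] using h

theorem IsSolution.add {V f g : ℝ → ℂ} {E : ℂ} (hf : IsSolution V E f)
    (hg : IsSolution V E g) : IsSolution V E (f + g) where
  acLocTwo := hf.acLocTwo.add hg.acLocTwo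
  eqn := by
    filter_upwards [hf.acLocTwo.diffExpr_add V hg.acLocTwo, hf.eqn, hg.eqn] with x h h1 h2
    simp [h, h1, h2, mul_add]

theorem IsSolution.smul {V f : ℝ → ℂ} {E : ℂ} (c : ℂ) (hf : IsSolution V E f) :
    IsSolution V E (c • f) where
  acLocTwo := hf.acLocTwo.smul c
  eqn := by
    filter_upwards [hf.acLocTwo.diffExpr_smul V c, hf.eqn] with x h h1
    simp only [h, h1, Pi.smul_apply, smul_eq_mul]
    ring

theorem IsSolution.comp_add_period {V ψ : ℝ → ℂ} {E : ℂ} {ω : ℝ} (hper : Function.Periodic V ω)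
    (h : IsSolution V E ψ) : IsSolution V E fun x => ψ (x + ω) := by
  refine isSolution_of_hasACDeriv (ψ' := fun x => deriv ψ (x + ω))
    (fun x => (h.acLocTwo.differentiable (x + ω)).hasDerivAt.comp_add_const x ω) ?_
  have := h.hasACDeriv_deriv.comp_add_const ω
  simpa only [hper _] using this

/-- Cramer's rule: two solutions with Wronskian `w ≠ 0` span the space of solutions. -/
theorem wronskian_cramer (f φ ψ : ℝ → ℂ) (x : ℝ) :
    wronskian φ ψ x * f x = wronskian f ψ x * φ x - wronskian f φ x * ψ x := by
  simp only [wronskian]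
  ring

/-! ### The Volterra equation in a weighted space -/

section Volterra

variable {a : ℝ → ℝ} {b : ℝ → ℂ}

/-- The weight `exp (2 |∫₀ˣ a|)`. In the corresponding weighted supremum norm, Volterra operators
with kernel dominated by `a` have norm at most `1 / 2` on the whole line. -/
def weight (a : ℝ → ℝ) (x : ℝ) : ℝ := Real.exp (2 * |∫ t in (0 : ℝ)..x, a t|)

theorem weight_pos (a : ℝ → ℝ) (x : ℝ) : 0 < weight a x := Real.exp_pos _

theorem one_le_weight (a : ℝ → ℝ) (x : ℝ) : 1 ≤ weight a x :=
  Real.one_le_exp (by positivity)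

theorem continuous_weight (ha : ∀ x y, IntervalIntegrable a volume x y) :
    Continuous (weight a) := by
  have := intervalIntegral.continuous_primitive (fun x y => ha x y) 0
  unfold weight
  fun_prop

theorem integral_mul_exp (ha : ∀ x y, IntervalIntegrable a volume x y) (c x : ℝ) :
    ∫ t in (0 : ℝ)..x, c * a t * Real.exp (c * ∫ s in (0 : ℝ)..t, a s)
      = Real.exp (c * ∫ s in (0 : ℝ)..x, a s) - 1 := by
  have h1 := (ha 0 x).absolutelyContinuousOnInterval_intervalIntegral (c := 0) left_mem_uIcc
  have h2 := h1.contDiff_comp (g := fun y => Real.exp (c * y)) (by fun_prop)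
  have h3 := h2.integral_deriv_eq_sub
  simp only [Function.comp, intervalIntegral.integral_same, mul_zero, Real.exp_zero] at h3
  rw [← h3]
  refine intervalIntegral.integral_congr_ae ?_
  filter_upwards [(ha 0 x).ae_hasDerivAt_integral] with t ht htx
  have := ht (uIoc_subset_uIcc htx) 0 left_mem_uIcc
  refine Eq.trans ?_ ((this.const_mul c).exp).deriv.symm
  ring

/-- The bound behind the contraction property: `∫ a exp (2 ∫ a)` is half of an increment of
`exp (2 ∫ a)`. -/
theorem abs_integral_mul_weight_le (ha : ∀ x y, IntervalIntegrable a volume x y)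
    (ha0 : ∀ x, 0 ≤ a x) (x : ℝ) :
    |∫ t in (0 : ℝ)..x, a t * weight a t| ≤ weight a x / 2 := by
  -- On either half line the weight is `exp (c ∫₀ˣ a)` with `c = ±2`.
  have key : ∀ c : ℝ, |c| = 2 →
      (∀ t ∈ uIcc 0 x, 2 * |∫ s in (0 : ℝ)..t, a s| = c * ∫ s in (0 : ℝ)..t, a s) →
      |∫ t in (0 : ℝ)..x, a t * weight a t| ≤ weight a x / 2 := by
    intro c hc h
    have h1 := integral_mul_exp ha c x
    have h2 : ∫ t in (0 : ℝ)..x, a t * weight a t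
        = c⁻¹ * ∫ t in (0 : ℝ)..x, c * a t * Real.exp (c * ∫ s in (0 : ℝ)..t, a s) := by
      rw [← intervalIntegral.integral_const_mul]
      refine intervalIntegral.integral_congr fun t ht => ?_
      have : c ≠ 0 := by rintro rfl; simp at hc
      simp only [weight, h t ht]
      field_simp
    have h3 := h x right_mem_uIcc
    have h4 := one_le_weight a x
    rw [h2, h1, ← h3, ← weight, abs_mul, abs_inv, hc, abs_of_nonneg (by linarith)]
    linarith
  rcases le_total 0 x with hx | hx
  · refine key 2 (by norm_num) fun t ht => ?_
    rw [uIcc_of_le hx] at ht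
    rw [abs_of_nonneg (intervalIntegral.integral_nonneg ht.1 fun s _ => ha0 s)]
  · refine key (-2) (by norm_num) fun t ht => ?_
    rw [uIcc_of_ge hx] at ht
    rw [intervalIntegral.integral_symm, abs_neg,
      abs_of_nonneg (intervalIntegral.integral_nonneg ht.2 fun s _ => ha0 s)]
    ring

/-- The hypotheses on a majorant `a` and a coefficient `b` dominated by it. -/
structure Dominates (a : ℝ → ℝ) (b : ℝ → ℂ) : Prop where
  intervalIntegrable : ∀ x y, IntervalIntegrable a volume x y
  aestronglyMeasurable : AEStronglyMeasurable b volume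
  norm_le : ∀ x, ‖b x‖ ≤ a x

theorem Dominates.nonneg (h : Dominates a b) (x : ℝ) : 0 ≤ a x :=
  (norm_nonneg _).trans (h.norm_le x)

theorem Dominates.locallyIntegrable (h : Dominates a b) : LocallyIntegrable b :=
  locallyIntegrable_of_intervalIntegrable fun x y =>
    (h.intervalIntegrable x y).mono_fun h.aestronglyMeasurable.restrict
      (Eventually.of_forall fun t => (h.norm_le t).trans (le_abs_self _))

theorem Dominates.locallyIntegrable_mul (h : Dominates a b) {z : ℝ → ℂ} (hz : Continuous z) :
    LocallyIntegrable fun t => b t * z t :=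
  locallyIntegrable_of_intervalIntegrable fun x y =>
    (h.locallyIntegrable.intervalIntegrable_real x y).mul_continuousOn hz.continuousOn

theorem Dominates.norm_integral_le (h : Dominates a b) (z : BoundedContinuousFunction ℝ ℂ)
    (x : ℝ) :
    ‖((weight a x)⁻¹ : ℂ) * ∫ t in (0 : ℝ)..x, b t * (weight a t * z t)‖ ≤ 1 / 2 * ‖z‖ := by
  have hw := weight_pos a x
  have hc := continuous_weight h.intervalIntegrable
  have h1 : ‖∫ t in (0 : ℝ)..x, b t * (weight a t * z t)‖
      ≤ |∫ t in (0 : ℝ)..x, a t * weight a t * ‖z‖| := by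
    refine intervalIntegral.norm_integral_le_abs_of_norm_le ?_ ?_
    · refine ae_of_all _ fun t => ?_
      rw [norm_mul, norm_mul, Complex.norm_real, Real.norm_of_nonneg (weight_pos a t).le, mul_assoc]
      have := (weight_pos a t).le
      have := z.norm_coe_le_norm t
      have := h.norm_le t
      have := h.nonneg t
      gcongr
    · exact ((h.intervalIntegrable 0 x).mul_continuousOn hc.continuousOn).mul_const _
  rw [intervalIntegral.integral_mul_const, abs_mul, abs_norm] at h1
  have h2 := abs_integral_mul_weight_le h.intervalIntegrable h.nonneg x
  rw [norm_mul, norm_inv, Complex.norm_real, Real.norm_of_nonneg hw.le, inv_mul_le_iff₀ hw]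
  refine h1.trans ((mul_le_mul_of_nonneg_right h2 (norm_nonneg _)).trans (le_of_eq ?_))
  ring

/-- The Volterra operator `f ↦ ∫₀ˣ b f`, conjugated by the weight, on the bounded continuous
functions. -/
def volterra (h : Dominates a b) :
    BoundedContinuousFunction ℝ ℂ →L[ℂ] BoundedContinuousFunction ℝ ℂ :=
  LinearMap.mkContinuous
    { toFun := fun z => BoundedContinuousFunction.ofNormedAddCommGroup
        (fun x => ((weight a x)⁻¹ : ℂ) * ∫ t in (0 : ℝ)..x, b t * (weight a t * z t))
        (by
          have hc := continuous_weight h.intervalIntegrable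
          have hi := (acLoc_integral (h.locallyIntegrable_mul (z := fun t => weight a t * z t)
            (by fun_prop)) 0).continuous
          refine Continuous.mul (Continuous.inv₀ (by fun_prop) fun x => ?_) hi
          exact_mod_cast (weight_pos a x).ne')
        (1 / 2 * ‖z‖) (h.norm_integral_le z)
      map_add' := fun z w => by
        ext x
        have hc := continuous_weight h.intervalIntegrable
        have hi : ∀ z : BoundedContinuousFunction ℝ ℂ, IntervalIntegrable
            (fun t => b t * (weight a t * z t)) volume 0 x := fun z =>
          (h.locallyIntegrable_mul (z := fun t => weight a t * z t)
            (by fun_prop)).intervalIntegrable_real 0 x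
        simp only [BoundedContinuousFunction.coe_ofNormedAddCommGroup,
          BoundedContinuousFunction.coe_add, Pi.add_apply, mul_add]
        rw [intervalIntegral.integral_add (hi z) (hi w), mul_add]
      map_smul' := fun c z => by
        ext x
        simp only [BoundedContinuousFunction.coe_ofNormedAddCommGroup,
          BoundedContinuousFunction.coe_smul, smul_eq_mul, RingHom.id_apply]
        rw [mul_left_comm c, ← intervalIntegral.integral_const_mul c]
        congr 1
        refine intervalIntegral.integral_congr fun t _ => ?_
        ring }
    (1 / 2) fun z => by
      refine (BoundedContinuousFunction.norm_le (by positivity)).2 (h.norm_integral_le z)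

theorem volterra_apply (h : Dominates a b) (z : BoundedContinuousFunction ℝ ℂ) (x : ℝ) :
    volterra h z x = ((weight a x)⁻¹ : ℂ) * ∫ t in (0 : ℝ)..x, b t * (weight a t * z t) := rfl

theorem norm_volterra_le (h : Dominates a b) : ‖volterra h‖ ≤ 1 / 2 :=
  LinearMap.mkContinuous_norm_le _ (by norm_num) _

theorem volterra_sub_smul {a : ℝ → ℝ} {b c d : ℝ → ℂ} (hb : Dominates a b) (hc : Dominates a c)
    (hd : Dominates a d) (E : ℂ) (h : ∀ x, d x = b x - E * c x) :
    volterra hd = volterra hb - E • volterra hc := by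
  ext z x
  have hw := continuous_weight hb.intervalIntegrable
  have hi : ∀ {b : ℝ → ℂ}, Dominates a b → IntervalIntegrable
      (fun t => b t * (weight a t * z t)) volume 0 x := fun h =>
    (h.locallyIntegrable_mul (z := fun t => weight a t * z t)
      (by fun_prop)).intervalIntegrable_real 0 x
  simp only [_root_.sub_apply, _root_.smul_apply,
    BoundedContinuousFunction.coe_sub, BoundedContinuousFunction.coe_smul, Pi.sub_apply,
    volterra_apply, smul_eq_mul]
  rw [mul_left_comm E, ← mul_sub, ← intervalIntegral.integral_const_mul E,
    ← intervalIntegral.integral_sub (hi hb) ((hi hc).const_mul E)]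
  congr 1
  refine intervalIntegral.integral_congr fun t _ => ?_
  simp only [h]
  ring

/-- The reciprocal of the weight as a bounded continuous function. -/
def invWeight {a : ℝ → ℝ} (ha : ∀ x y, IntervalIntegrable a volume x y) :
    BoundedContinuousFunction ℝ ℂ :=
  BoundedContinuousFunction.ofNormedAddCommGroup (fun x => ((weight a x)⁻¹ : ℂ))
    (by
      have hc := continuous_weight ha
      refine Continuous.inv₀ (by fun_prop) fun x => ?_
      exact_mod_cast (weight_pos a x).ne')
    1 fun x => by
      rw [norm_inv, Complex.norm_real, Real.norm_of_nonneg (weight_pos a x).le]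
      exact inv_le_one_of_one_le₀ (one_le_weight a x)

theorem invWeight_apply {a : ℝ → ℝ} (ha : ∀ x y, IntervalIntegrable a volume x y) (x : ℝ) :
    invWeight ha x = ((weight a x)⁻¹ : ℂ) := rfl

end Volterra

theorem differentiableAt_inverse_one_sub {A : Type*} [NormedRing A] [NormedAlgebra ℂ A]
    [CompleteSpace A] (S B : A) {E : ℂ} (h : IsUnit (1 - S * (B - E • S))) :
    DifferentiableAt ℂ (fun E : ℂ => Ring.inverse (1 - S * (B - E • S))) E := by
  have h1 : DifferentiableAt ℂ (fun E : ℂ => 1 - S * (B - E • S)) E :=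
    (((differentiableAt_id.smul_const S).const_sub B).const_mul S).const_sub 1
  exact DifferentiableAt.comp (g := Ring.inverse) E (differentiableAt_inverse h) h1

/-- For `‖E‖ < R`, solutions with given initial data exist and depend holomorphically on `E`,
together with their derivatives: they are obtained by inverting `1 - K(E)` where `K(E)` is a
Volterra operator of norm less than `1`, affine in `E`. -/
theorem exists_holomorphic_solution {V : ℝ → ℂ} (hV : LocallyIntegrable V) (R : ℝ) (hR : 0 ≤ R)
    (α β : ℂ) : ∃ u v : ℂ → ℝ → ℂ,
      (∀ E, ‖E‖ < R → IsSolution V E (u E) ∧ deriv (u E) = v E ∧ u E 0 = α ∧ v E 0 = β) ∧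
      ∀ x, DifferentiableOn ℂ (fun E => u E x) (Metric.ball 0 R) ∧
        DifferentiableOn ℂ (fun E => v E x) (Metric.ball 0 R) := by
  set a : ℝ → ℝ := fun x => 1 + R + ‖V x‖ with ha_def
  have ha : ∀ x y, IntervalIntegrable a volume x y := fun x y =>
    intervalIntegrable_const.add (hV.intervalIntegrable_real x y).norm
  have hdV : Dominates a V :=
    ⟨ha, hV.aestronglyMeasurable, fun x => by simp only [ha_def]; linarith⟩
  have hd1 : Dominates a fun _ => (1 : ℂ) := ⟨ha, aestronglyMeasurable_const, fun x => by
    have := norm_nonneg (V x)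
    simp only [ha_def, norm_one]; linarith⟩
  have hdE : ∀ E : ℂ, ‖E‖ < R → Dominates a fun x => V x - E := fun E hE =>
    ⟨ha, hV.aestronglyMeasurable.sub aestronglyMeasurable_const, fun x => by
      have := norm_sub_le (V x) E
      simp only [ha_def]; linarith⟩
  set S := volterra hd1 with hS
  let T : ℂ → BoundedContinuousFunction ℝ ℂ →L[ℂ] BoundedContinuousFunction ℝ ℂ :=
    fun E => volterra hdV - E • S
  have hT : ∀ E (hE : ‖E‖ < R), volterra (hdE E hE) = T E := fun E hE =>
    volterra_sub_smul hdV hd1 (hdE E hE) E fun x => by ring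
  have hunit : ∀ E, ‖E‖ < R → IsUnit (1 - S * T E) := fun E hE => by
    refine isUnit_one_sub_of_norm_lt_one ((ContinuousLinearMap.opNorm_comp_le S (T E)).trans_lt ?_)
    have h1 := norm_volterra_le hd1
    have h2 := norm_volterra_le (hdE E hE)
    rw [hT E hE] at h2
    have h3 := norm_nonneg S
    have h4 := norm_nonneg (T E)
    nlinarith
  let z₁ : ℂ → BoundedContinuousFunction ℝ ℂ := fun E =>
    Ring.inverse (1 - S * T E) (α • invWeight ha + S (β • invWeight ha))
  let z₂ : ℂ → BoundedContinuousFunction ℝ ℂ := fun E => β • invWeight ha + T E (z₁ E)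
  have hz₁ : ∀ E, ‖E‖ < R → z₁ E = α • invWeight ha + S (z₂ E) := fun E hE => by
    have h1 := congrArg (fun A : BoundedContinuousFunction ℝ ℂ →L[ℂ] BoundedContinuousFunction ℝ ℂ
      => A (α • invWeight ha + S (β • invWeight ha))) (Ring.mul_inverse_cancel _ (hunit E hE))
    simp only [mul_apply_eq_comp, _root_.sub_apply,
      one_apply_eq_self] at h1
    simp only [z₂, map_add]
    rw [← add_assoc, ← h1]
    exact (sub_add_cancel _ _).symm
  have hcw := continuous_weight ha
  have hw : ∀ x, (weight a x : ℂ) ≠ 0 := fun x => by exact_mod_cast (weight_pos a x).ne'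
  have hu : ∀ E, ‖E‖ < R → ∀ x, weight a x * z₁ E x
      = α + ∫ t in (0 : ℝ)..x, 1 * (weight a t * z₂ E t) := fun E hE x => by
    rw [hz₁ E hE, BoundedContinuousFunction.coe_add, Pi.add_apply,
      BoundedContinuousFunction.coe_smul, hS, volterra_apply]
    simp only [invWeight_apply, smul_eq_mul]
    have := hw x
    field_simp
  have hv : ∀ E, ‖E‖ < R → ∀ x, weight a x * z₂ E x
      = β + ∫ t in (0 : ℝ)..x, (V t - E) * (weight a t * z₁ E t) := fun E hE x => by
    simp only [z₂]
    rw [← hT E hE, BoundedContinuousFunction.coe_add, Pi.add_apply,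
      BoundedContinuousFunction.coe_smul, volterra_apply]
    simp only [invWeight_apply, smul_eq_mul]
    have := hw x
    field_simp
  have hTd : Differentiable ℂ T := by
    intro E
    exact (differentiableAt_const _).sub (differentiableAt_id.smul_const S)
  have hz₁d : DifferentiableOn ℂ z₁ (Metric.ball 0 R) := by
    intro E hE
    rw [mem_ball_zero_iff] at hE
    have h3 : DifferentiableAt ℂ (fun E => Ring.inverse (1 - S * T E)) E :=
      differentiableAt_inverse_one_sub S (volterra hdV) (hunit E hE)
    exact (h3.clm_apply (differentiableAt_const _)).differentiableWithinAt
  have hz₂d : DifferentiableOn ℂ z₂ (Metric.ball 0 R) :=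
    (differentiableOn_const _).add (hTd.differentiableOn.clm_apply hz₁d)
  refine ⟨fun E x => weight a x * z₁ E x, fun E x => weight a x * z₂ E x, fun E hE => ?_,
    fun x => ?_⟩
  · have hac : HasACDeriv (fun x => (weight a x : ℂ) * z₂ E x)
        fun x => (V x - E) * (weight a x * z₁ E x) := by
      have := (hasACDeriv_const β).add (hasACDeriv_integral
        ((hdE E hE).locallyIntegrable_mul (z := fun t => weight a t * z₁ E t) (by fun_prop)) 0)
      simpa only [← hv E hE, zero_add] using this
    have hd : ∀ x, HasDerivAt (fun x => (weight a x : ℂ) * z₁ E x) (weight a x * z₂ E x) x := by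
      have hc : Continuous fun t => (weight a t : ℂ) * z₂ E t := by fun_prop
      have := (hasACDeriv_const α).add (hasACDeriv_integral
        (hd1.locallyIntegrable_mul (z := fun t => weight a t * z₂ E t) hc) 0)
      simp only [← hu E hE, zero_add] at this
      simp only [one_mul] at this
      exact this.hasDerivAt hc
    refine ⟨isSolution_of_hasACDeriv hd hac, funext fun x => (hd x).deriv, ?_, ?_⟩
    · simp [hu E hE]
    · simp [hv E hE]
  · have hev : ∀ {z : ℂ → BoundedContinuousFunction ℝ ℂ}, DifferentiableOn ℂ z (Metric.ball 0 R) →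
        DifferentiableOn ℂ (fun E => (weight a x : ℂ) * z E x) (Metric.ball 0 R) := fun hz =>
      ((BoundedContinuousFunction.evalCLM ℂ x).differentiable.comp_differentiableOn hz).const_mul _
    exact ⟨hev hz₁d, hev hz₂d⟩

theorem exists_isSolution {V : ℝ → ℂ} (hV : LocallyIntegrable V) (E α β : ℂ) :
    ∃ ψ, IsSolution V E ψ ∧ ψ 0 = α ∧ deriv ψ 0 = β := by
  obtain ⟨u, v, h, -⟩ := exists_holomorphic_solution hV (‖E‖ + 1) (by positivity) α β
  obtain ⟨h1, h2, h3, h4⟩ := h E (by linarith)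
  exact ⟨u E, h1, h3, by rw [h2, h4]⟩

section Solution

variable {V : ℝ → ℂ} (hV : LocallyIntegrable V) (E α β : ℂ)
include hV

theorem solution_spec :
    IsSolution V E (solution V E α β) ∧ solution V E α β 0 = α ∧ deriv (solution V E α β) 0 = β :=
  Classical.epsilon_spec (exists_isSolution hV E α β)

theorem isSolution_phi₁ : IsSolution V E (phi₁ V E) := (solution_spec hV E 1 0).1
theorem isSolution_phi₂ : IsSolution V E (phi₂ V E) := (solution_spec hV E 0 1).1
theorem phi₁_zero : phi₁ V E 0 = 1 := (solution_spec hV E 1 0).2.1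
theorem deriv_phi₁_zero : deriv (phi₁ V E) 0 = 0 := (solution_spec hV E 1 0).2.2
theorem phi₂_zero : phi₂ V E 0 = 0 := (solution_spec hV E 0 1).2.1
theorem deriv_phi₂_zero : deriv (phi₂ V E) 0 = 1 := (solution_spec hV E 0 1).2.2

theorem wronskian_phi (x : ℝ) : wronskian (phi₁ V E) (phi₂ V E) x = 1 := by
  rw [(isSolution_phi₁ hV E).wronskian_eq (isSolution_phi₂ hV E) x 0]
  simp [wronskian, phi₁_zero hV, deriv_phi₁_zero hV, phi₂_zero hV, deriv_phi₂_zero hV]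

theorem IsSolution.eq_phi {ψ : ℝ → ℂ} (hψ : IsSolution V E ψ) :
    ψ = ψ 0 • phi₁ V E + deriv ψ 0 • phi₂ V E := by
  funext x
  have h := wronskian_cramer ψ (phi₁ V E) (phi₂ V E) x
  rw [wronskian_phi hV E, hψ.wronskian_eq (isSolution_phi₂ hV E) x 0,
    hψ.wronskian_eq (isSolution_phi₁ hV E) x 0] at h
  simp only [wronskian, phi₁_zero hV, deriv_phi₁_zero hV, phi₂_zero hV, deriv_phi₂_zero hV] at h
  simp only [Pi.add_apply, Pi.smul_apply, smul_eq_mul]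
  linear_combination h

theorem IsSolution.ext {ψ χ : ℝ → ℂ} {E : ℂ} (hψ : IsSolution V E ψ) (hχ : IsSolution V E χ)
    (h0 : ψ 0 = χ 0) (h1 : deriv ψ 0 = deriv χ 0) : ψ = χ := by
  rw [hψ.eq_phi hV, hχ.eq_phi hV, h0, h1]

/-- The Floquet discriminant is an entire function. -/
theorem differentiable_discriminant (ω : ℝ) : Differentiable ℂ (discriminant V ω) := by
  intro E₀
  set R := ‖E₀‖ + 1 with hR
  obtain ⟨u₁, v₁, h₁, d₁⟩ := exists_holomorphic_solution hV R (by positivity) 1 0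
  obtain ⟨u₂, v₂, h₂, d₂⟩ := exists_holomorphic_solution hV R (by positivity) 0 1
  have hball : Metric.ball (0 : ℂ) R ∈ 𝓝 E₀ :=
    Metric.isOpen_ball.mem_nhds (by rw [mem_ball_zero_iff]; linarith)
  have hd : DifferentiableAt ℂ (fun E => (u₁ E ω + v₂ E ω) / 2) E₀ :=
    (((d₁ ω).1.differentiableAt hball).add ((d₂ ω).2.differentiableAt hball)).div_const 2
  refine hd.congr_of_eventuallyEq ?_
  filter_upwards [hball] with E hE
  rw [mem_ball_zero_iff] at hE
  obtain ⟨s₁, e₁, a₁, b₁⟩ := h₁ E hE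
  obtain ⟨s₂, e₂, a₂, b₂⟩ := h₂ E hE
  have k₁ : phi₁ V E = u₁ E := (isSolution_phi₁ hV E).ext hV s₁
    (by rw [phi₁_zero hV, a₁]) (by rw [deriv_phi₁_zero hV, e₁, b₁])
  have k₂ : phi₂ V E = u₂ E := (isSolution_phi₂ hV E).ext hV s₂
    (by rw [phi₂_zero hV, a₂]) (by rw [deriv_phi₂_zero hV, e₂, b₂])
  simp [discriminant, monodromy, Matrix.trace_fin_two, k₁, k₂, e₂]

end Solution

/-! ### Floquet solutions -/

theorem monodromy_det {V : ℝ → ℂ} (hV : LocallyIntegrable V) (ω : ℝ) (E : ℂ) :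
    (monodromy V ω E).det = 1 := by
  rw [← wronskian_phi hV E ω, monodromy, Matrix.det_fin_two_of, wronskian]
  ring

theorem deriv_floquet {ψ : ℝ → ℂ} {ω : ℝ} {ρ : ℂ} (h : ∀ x, ψ (x + ω) = ρ * ψ x) (x : ℝ) :
    deriv ψ (x + ω) = ρ * deriv ψ x := by
  have := congrArg (fun f : ℝ → ℂ => deriv f x) (funext h)
  simpa [deriv_comp_add_const] using this

theorem exists_floquet_solution {V : ℝ → ℂ} (hV : LocallyIntegrable V) {ω : ℝ}
    (hper : Function.Periodic V ω) {E ρ : ℂ} (hρ : ρ ^ 2 - 2 * discriminant V ω E * ρ + 1 = 0) :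
    ∃ ψ, IsSolution V E ψ ∧ ψ ≠ 0 ∧ ∀ x, ψ (x + ω) = ρ * ψ x := by
  have hdet := monodromy_det hV ω E
  have hdisc : 2 * discriminant V ω E = phi₁ V E ω + deriv (phi₂ V E) ω := by
    rw [discriminant, Matrix.trace_fin_two]
    simp [monodromy]
    ring
  simp only [monodromy, Matrix.det_fin_two_of] at hdet
  -- The initial data of the solution form an eigenvector of the monodromy matrix.
  obtain ⟨v, hv0, hv⟩ := (Matrix.exists_mulVec_eq_zero_iff
    (M := !![phi₁ V E ω - ρ, phi₂ V E ω; deriv (phi₁ V E) ω, deriv (phi₂ V E) ω - ρ])).2 (by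
      rw [Matrix.det_fin_two_of]
      linear_combination hρ + hdet + ρ * hdisc)
  have e0 := congrFun hv 0
  have e1 := congrFun hv 1
  simp [Matrix.mulVec, dotProduct, Fin.sum_univ_two] at e0 e1
  have s1 := isSolution_phi₁ hV E
  have s2 := isSolution_phi₂ hV E
  have hs := (s1.smul (v 0)).add (s2.smul (v 1))
  set ψ := v 0 • phi₁ V E + v 1 • phi₂ V E with hψ
  have hd : deriv ψ = v 0 • deriv (phi₁ V E) + v 1 • deriv (phi₂ V E) := by
    rw [hψ, (s1.smul (v 0)).acLocTwo.deriv_add (s2.smul (v 1)).acLocTwo,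
      s1.acLocTwo.deriv_smul, s2.acLocTwo.deriv_smul]
  have i0 : ψ 0 = v 0 := by simp [hψ, phi₁_zero hV, phi₂_zero hV]
  have i1 : deriv ψ 0 = v 1 := by simp [hd, deriv_phi₁_zero hV, deriv_phi₂_zero hV]
  refine ⟨ψ, hs, fun h => hv0 ?_, fun x => ?_⟩
  · funext i
    fin_cases i
    · simp [← i0, h]
    · have : deriv (0 : ℝ → ℂ) 0 = 0 := by simp
      simp [← i1, h, this]
  · have h := (hs.comp_add_period hper).ext hV (hs.smul ρ) ?_ ?_
    · exact congrFun h x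
    · simp only [zero_add, Pi.smul_apply, smul_eq_mul, i0]
      simp only [hψ, Pi.add_apply, Pi.smul_apply, smul_eq_mul]
      linear_combination e0
    · rw [hs.acLocTwo.deriv_smul]
      simp only [deriv_comp_add_const, zero_add, Pi.smul_apply, smul_eq_mul, i1]
      simp only [hd, Pi.add_apply, Pi.smul_apply, smul_eq_mul]
      linear_combination e1

/-- A continuous function with Floquet multiplier `ρ` grows like `|ρ| ^ (x / ω)`. -/
theorem norm_floquet_le {f : ℝ → ℂ} (hf : Continuous f) {ω : ℝ} (hω : 0 < ω) {ρ : ℂ}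
    (hρ : ρ ≠ 0) (h : ∀ x, f (x + ω) = ρ * f x) :
    ∃ C, 0 ≤ C ∧ ∀ x, ‖f x‖ ≤ C * Real.exp (Real.log ‖ρ‖ / ω * x) := by
  set l := Real.log ‖ρ‖ / ω with hl
  have hper : Function.Periodic (fun x => ‖f x‖ * Real.exp (-(l * x))) ω := by
    intro x
    have h1 : -(l * (x + ω)) = -(l * x) - Real.log ‖ρ‖ := by
      rw [hl]; field_simp; ring
    have h2 := norm_pos_iff.2 hρ
    simp only [h, h1, Real.exp_sub, Real.exp_log h2, norm_mul]
    field_simp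
  obtain ⟨C, hC⟩ := (hper.isBounded_of_continuous hω.ne' (by fun_prop)).exists_norm_le
  refine ⟨C, (norm_nonneg _).trans (hC _ ⟨0, rfl⟩), fun x => ?_⟩
  have h3 := (le_abs_self _).trans (hC _ ⟨x, rfl⟩)
  simp only [Real.exp_neg] at h3
  rwa [← div_eq_mul_inv, div_le_iff₀ (Real.exp_pos _)] at h3

/-! ### Square integrable functions and Wronskians on half lines -/

/-- If `F` and `G` are square integrable on a half line and `F' = G - c` there, then `c = 0`:
otherwise `|F|` would grow at least linearly, since `∫ |G|` grows at most like a small multiple of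
the length of the interval. -/
theorem eq_zero_of_sub_eq_integral_Ici {F G : ℝ → ℂ} {a : ℝ} {c : ℂ}
    (hF : MemLp F 2 (volume.restrict (Ici a))) (hG : MemLp G 2 (volume.restrict (Ici a)))
    (h : ∀ x, a ≤ x → F x = F a + ((∫ t in a..x, G t) - c * (x - a))) : c = 0 := by
  by_contra hc
  set δ := ‖c‖
  have hδ0 : 0 < δ := norm_pos_iff.2 hc
  have hF2 := (memLp_two_iff_integrable_sq_norm hF.1).1 hF
  have hG2 := (memLp_two_iff_integrable_sq_norm hG.1).1 hG
  set K := ∫ t in Ici a, ‖G t‖ ^ 2 with hK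
  have hsub : ∀ x, Ioc a x ⊆ Ici a := fun x t ht => ht.1.le
  have hb : ∀ x, a ≤ x → ‖∫ t in a..x, G t‖ ≤ δ / 2 * (x - a) + K / (2 * δ) := by
    intro x hx
    have hi : IntegrableOn (fun t => ‖G t‖ ^ 2) (Ioc a x) := hG2.mono_measure
      (Measure.restrict_mono (hsub x) le_rfl)
    have hc' : IntegrableOn (fun _ => δ / 2) (Ioc a x) := by
      rw [integrableOn_const_iff]; right; simp
    calc ‖∫ t in a..x, G t‖ = ‖∫ t in Ioc a x, G t‖ := by rw [intervalIntegral.integral_of_le hx]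
      _ ≤ ∫ t in Ioc a x, (δ / 2 + ‖G t‖ ^ 2 / (2 * δ)) := by
        refine norm_integral_le_of_norm_le (hc'.add (hi.div_const _)) (ae_of_all _ fun t => ?_)
        -- Weighted AM-GM: `|G| ≤ δ / 2 + |G|² / (2 δ)`.
        have e : δ / 2 + ‖G t‖ ^ 2 / (2 * δ) - ‖G t‖ = (δ - ‖G t‖) ^ 2 / (2 * δ) := by
          field_simp; ring
        have : 0 ≤ (δ - ‖G t‖) ^ 2 / (2 * δ) := by positivity
        linarith
      _ = δ / 2 * (x - a) + (∫ t in Ioc a x, ‖G t‖ ^ 2) / (2 * δ) := by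
        rw [integral_add hc' (hi.div_const _), integral_div (2 * δ) fun t => ‖G t‖ ^ 2]
        simp only [setIntegral_const, smul_eq_mul, measureReal_def, Real.volume_Ioc]
        rw [ENNReal.toReal_ofReal (by linarith)]
        ring
      _ ≤ δ / 2 * (x - a) + K / (2 * δ) := by
        have : ∫ t in Ioc a x, ‖G t‖ ^ 2 ≤ K :=
          setIntegral_mono_set hG2 (ae_of_all _ fun t => by positivity)
            (Eventually.of_forall (hsub x))
        gcongr
  have hK0 : 0 ≤ K := integral_nonneg fun t => by positivity
  -- The point after which `δ (x - a)` exceeds the error terms by at least `1`.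
  set X := a + 2 / δ * (1 + ‖F a‖ + K / (2 * δ)) with hX
  have haX : a ≤ X := by
    have : 0 ≤ 2 / δ * (1 + ‖F a‖ + K / (2 * δ)) := by positivity
    linarith
  have hlow : ∀ x, X ≤ x → 1 ≤ ‖F x‖ := by
    intro x hx
    have hax := haX.trans hx
    have e1 : c * (x - a) = F a + (∫ t in a..x, G t) - F x := by rw [h x hax]; ring
    have e2 : ‖c * ((x : ℂ) - a)‖ = δ * (x - a) := by
      rw [norm_mul, ← Complex.ofReal_sub, Complex.norm_real, Real.norm_of_nonneg (by linarith)]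
    have e3 := (norm_sub_le (F a + ∫ t in a..x, G t) (F x)).trans
      (add_le_add_left (norm_add_le _ _) _)
    rw [← e1, e2] at e3
    have e4 := hb x hax
    have e5 : 1 + ‖F a‖ + K / (2 * δ) ≤ δ / 2 * (x - a) := by
      have : δ / 2 * (X - a) = 1 + ‖F a‖ + K / (2 * δ) := by rw [hX]; field_simp; ring
      rw [← this]
      gcongr
    linarith
  have h1 : IntegrableOn (fun _ : ℝ => (1 : ℝ)) (Ici X) := by
    refine Integrable.mono' (hF2.mono_measure (Measure.restrict_mono (Ici_subset_Ici.2 haX) le_rfl))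
      aestronglyMeasurable_const ?_
    filter_upwards [ae_restrict_mem measurableSet_Ici] with x hx
    have := hlow x hx
    simp only [norm_one]
    nlinarith
  rw [integrableOn_const_iff] at h1
  simp at h1

theorem eq_zero_of_sub_eq_integral_Iic {F G : ℝ → ℂ} {a : ℝ} {c : ℂ}
    (hF : MemLp F 2 (volume.restrict (Iic a))) (hG : MemLp G 2 (volume.restrict (Iic a)))
    (h : ∀ x, x ≤ a → F x = F a + ((∫ t in a..x, G t) - c * (x - a))) : c = 0 := by
  have hp : MeasurePreserving (fun x : ℝ => -x) (volume.restrict (Ici (-a)))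
      (volume.restrict (Iic a)) := by
    have := (Measure.measurePreserving_neg (volume : Measure ℝ)).restrict_preimage
      (measurableSet_Iic (a := a))
    have e : (Neg.neg : ℝ → ℝ) ⁻¹' Iic a = Ici (-a) := by ext x; simp
    rwa [e] at this
  have := eq_zero_of_sub_eq_integral_Ici (F := fun x => F (-x)) (G := fun x => -G (-x)) (a := -a)
    (c := -c) (hF.comp_measurePreserving hp) (hG.comp_measurePreserving hp).neg (fun x hx => by
      rw [h (-x) (by linarith), intervalIntegral.integral_neg,
        intervalIntegral.integral_comp_neg (fun t => G t), intervalIntegral.integral_symm]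
      simp only [neg_neg]
      push_cast
      ring)
  simpa using this

section HalfLine

variable {f ψ : ℝ → ℂ} (hf : ACLocTwo f) (hfL : MemLp f 2 volume) (hψ : ACLocTwo ψ) {C : ℝ}
include hf hψ

/-- Where the Wronskian is equal to `c`, `(f ψ)' = 2 f ψ' - c`; this form does not contain `f'`,
about which nothing is known beyond continuity. -/
theorem mul_eq_of_wronskian_eq {a x : ℝ} {c : ℂ} (h : ∀ t ∈ uIcc a x, wronskian f ψ t = c) :
    f x * ψ x = f a * ψ a + ((∫ t in a..x, 2 * (f t * deriv ψ t)) - c * (x - a)) := by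
  have h1 := (hf.hasACDeriv.mul hψ.hasACDeriv).integral_eq_sub a x
  have h2 : ∫ t in a..x, (deriv f t * ψ t + f t * deriv ψ t)
      = ∫ t in a..x, (2 * (f t * deriv ψ t) - c) := by
    refine intervalIntegral.integral_congr fun t ht => ?_
    have := h t ht
    simp only [wronskian] at this
    linear_combination -this
  have hi : IntervalIntegrable (fun t => 2 * (f t * deriv ψ t)) volume a x := by
    have := hf.differentiable.continuous
    have := hψ.continuous_deriv
    exact Continuous.intervalIntegrable (by fun_prop) _ _
  rw [h2, intervalIntegral.integral_sub hi intervalIntegrable_const,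
    intervalIntegral.integral_const] at h1
  rw [Complex.real_smul] at h1
  push_cast at h1
  linear_combination -h1

include hfL

theorem memLp_mul_of_bound {s : Set ℝ} (hs : MeasurableSet s) (hψC : ∀ x ∈ s, ‖ψ x‖ ≤ C)
    (hψC' : ∀ x ∈ s, ‖deriv ψ x‖ ≤ C) :
    MemLp (fun x => f x * ψ x) 2 (volume.restrict s) ∧
      MemLp (fun x => 2 * (f x * deriv ψ x)) 2 (volume.restrict s) := by
  have c1 := hf.differentiable.continuous
  have c2 := hψ.continuous_deriv
  have c3 := hψ.differentiable.continuous
  have key : ∀ g : ℝ → ℂ, Continuous g → (∀ x ∈ s, ‖g x‖ ≤ C) →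
      MemLp (fun x => f x * g x) 2 (volume.restrict s) := fun g hg hgC =>
    MemLp.of_le_mul (c := C) (hfL.restrict s) (by fun_prop) (by
      filter_upwards [ae_restrict_mem hs] with x hx
      rw [norm_mul, mul_comm]
      exact mul_le_mul_of_nonneg_right (hgC x hx) (norm_nonneg _))
  exact ⟨key ψ c3 hψC, (key _ c2 hψC').const_mul 2⟩

/-- On a half line, a constant Wronskian of an `L²` function and a bounded function with bounded
derivative vanishes. -/
theorem wronskian_eq_zero_Ici {a : ℝ} {c : ℂ} (hψC : ∀ x, a ≤ x → ‖ψ x‖ ≤ C)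
    (hψC' : ∀ x, a ≤ x → ‖deriv ψ x‖ ≤ C) (h : ∀ x, a ≤ x → wronskian f ψ x = c) : c = 0 := by
  obtain ⟨h1, h2⟩ := memLp_mul_of_bound hf hfL hψ measurableSet_Ici hψC hψC'
  refine eq_zero_of_sub_eq_integral_Ici h1 h2 fun x hx =>
    mul_eq_of_wronskian_eq hf hψ fun t ht => h t ?_
  rw [uIcc_of_le hx] at ht
  exact ht.1

theorem wronskian_eq_zero_Iic {a : ℝ} {c : ℂ} (hψC : ∀ x, x ≤ a → ‖ψ x‖ ≤ C)
    (hψC' : ∀ x, x ≤ a → ‖deriv ψ x‖ ≤ C) (h : ∀ x, x ≤ a → wronskian f ψ x = c) : c = 0 := by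
  obtain ⟨h1, h2⟩ := memLp_mul_of_bound hf hfL hψ measurableSet_Iic hψC hψC'
  refine eq_zero_of_sub_eq_integral_Iic h1 h2 fun x hx =>
    mul_eq_of_wronskian_eq hf hψ fun t ht => h t ?_
  rw [uIcc_of_ge hx] at ht
  exact ht.2

end HalfLine

/-! ### Points where a Floquet multiplier is unimodular belong to the spectrum -/

theorem hillOperator_apply_ae {V : ℝ → ℂ} (f : (hillOperator V).domain) {g : ℝ → ℂ}
    (h : IsDomRep V (f : L2) g) : hillOperator V f =ᵐ[volume] diffExpr V g := by
  have e : domRep V f = g := (isDomRep_domRep V f).unique h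
  have : hillOperator V f = (isDomRep_domRep V f).memLp.toLp := rfl
  rw [this, ← e]
  exact MemLp.coeFn_toLp _

theorem hillOperator_sub_smul_ae {V : ℝ → ℂ} (E : ℂ) (f : (hillOperator V).domain) {g : ℝ → ℂ}
    (h : IsDomRep V (f : L2) g) :
    (hillOperator V f - E • (f : L2) : L2) =ᵐ[volume] fun x => diffExpr V g x - E * g x := by
  filter_upwards [hillOperator_apply_ae f h, h.ae_eq,
    Lp.coeFn_sub (hillOperator V f) (E • (f : L2)), Lp.coeFn_smul E (f : L2)] with x h1 h2 h3 h4
  rw [h3, Pi.sub_apply, h4, Pi.smul_apply, h1, h2, smul_eq_mul]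

theorem IsDomRep.memLp_two {V : ℝ → ℂ} {f : L2} {g : ℝ → ℂ} (h : IsDomRep V f g) :
    MemLp g 2 volume := (memLp_congr_ae h.ae_eq).1 (Lp.memLp f)

theorem norm_floquet_le_of_norm_eq_one {f : ℝ → ℂ} (hf : Continuous f) {ω : ℝ} (hω : 0 < ω)
    {ρ : ℂ} (hρ : ‖ρ‖ = 1) (h : ∀ x, f (x + ω) = ρ * f x) : ∃ C, ∀ x, ‖f x‖ ≤ C := by
  obtain ⟨C, -, hC⟩ := norm_floquet_le hf hω (fun h0 => by simp [h0] at hρ) h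
  exact ⟨C, fun x => by simpa [hρ] using hC x⟩

/-- If a Floquet solution `ψ` has a unimodular multiplier, then `H - E` is not surjective:
an `L²` solution `f` of `(H - E) f = g` with `g = conj ψ` on one period and `0` elsewhere would have
Wronskian with `ψ` equal to `0` on both sides of the period, although it jumps by `∫ |ψ|²`. -/
theorem mem_spectrumSet_of_norm_eq_one {V : ℝ → ℂ} {ω : ℝ} (hω : 0 < ω)
    (hV : LocallyIntegrable V) (hper : Function.Periodic V ω) {E ρ : ℂ}
    (hρ : ρ ^ 2 - 2 * discriminant V ω E * ρ + 1 = 0) (hρ1 : ‖ρ‖ = 1) :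
    E ∈ spectrumSet (hillOperator V) := by
  rintro ⟨R, hR, -⟩
  obtain ⟨ψ, hψ, hψ0, hψρ⟩ := exists_floquet_solution hV hper hρ
  have hψc := hψ.acLocTwo.differentiable.continuous
  obtain ⟨C₁, hC₁⟩ := norm_floquet_le_of_norm_eq_one hψc hω hρ1 hψρ
  obtain ⟨C₂, hC₂⟩ := norm_floquet_le_of_norm_eq_one hψ.acLocTwo.continuous_deriv hω hρ1
    (deriv_floquet hψρ)
  set C := max C₁ C₂
  have hC₁' : ∀ x, ‖ψ x‖ ≤ C := fun x => (hC₁ x).trans (le_max_left _ _)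
  have hC₂' : ∀ x, ‖deriv ψ x‖ ≤ C := fun x => (hC₂ x).trans (le_max_right _ _)
  set g : ℝ → ℂ := (Ioc 0 ω).indicator fun x => starRingEnd ℂ (ψ x) with hg
  have hgL : MemLp g 2 volume := by
    rw [hg, memLp_indicator_iff_restrict measurableSet_Ioc]
    exact MemLp.of_bound (Continuous.aestronglyMeasurable (by fun_prop)) C
      (ae_of_all _ fun x => by simpa using hC₁' x)
  obtain ⟨hdom, hy⟩ := hR hgL.toLp
  have hrep : ∃ f, IsDomRep V (R hgL.toLp) f := hdom
  obtain ⟨f, hf⟩ := hrep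
  have hae : ∀ᵐ x, diffExpr V f x - E * f x = g x := by
    have h1 := hillOperator_sub_smul_ae E ⟨_, hdom⟩ hf
    simp only [hy] at h1
    filter_upwards [h1, hgL.coeFn_toLp] with x h2 h3
    rw [← h2, h3]
  have hW := wronskian_sub hf.acLocTwo hae hψ
  have hright : wronskian f ψ ω = 0 :=
    wronskian_eq_zero_Ici hf.acLocTwo hf.memLp_two hψ.acLocTwo (a := ω) (fun x _ => hC₁' x)
      (fun x _ => hC₂' x) fun x hx => by
      have h1 := hW ω x
      rw [intervalIntegral.integral_of_le hx, setIntegral_congr_fun (g := fun _ => 0)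
        measurableSet_Ioc (fun t ht => by
          simp [hg, indicator_of_notMem (fun h : t ∈ Ioc 0 ω => not_lt.2 h.2 ht.1)])] at h1
      simpa [sub_eq_zero] using h1
  have hleft : wronskian f ψ 0 = 0 :=
    wronskian_eq_zero_Iic hf.acLocTwo hf.memLp_two hψ.acLocTwo (a := 0) (fun x _ => hC₁' x)
      (fun x _ => hC₂' x) fun x hx => by
      have h1 := hW x 0
      rw [intervalIntegral.integral_of_le hx, setIntegral_congr_fun (g := fun _ => 0)
        measurableSet_Ioc (fun t ht => by
          simp [hg, indicator_of_notMem (fun h : t ∈ Ioc 0 ω => not_lt.2 ht.2 h.1)])] at h1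
      rw [integral_zero, sub_eq_zero] at h1
      exact h1.symm
  have h1 := hW 0 ω
  rw [hright, hleft, intervalIntegral.integral_of_le hω.le,
    setIntegral_congr_fun (g := fun t => ((‖ψ t‖ ^ 2 : ℝ) : ℂ)) measurableSet_Ioc (fun t ht => by
      simp only [hg, indicator_of_mem ht, Complex.conj_mul']
      push_cast; rfl),
    ← intervalIntegral.integral_of_le hω.le, intervalIntegral.integral_ofReal] at h1
  have h2 : ∫ t in (0 : ℝ)..ω, ‖ψ t‖ ^ 2 = 0 := by
    rw [sub_zero] at h1; exact_mod_cast h1.symm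
  -- A solution that vanishes on a whole period vanishes identically.
  have h3 : ∀ t ∈ Icc 0 ω, ψ t = 0 := by
    intro t ht
    by_contra hne
    have : 0 < ∫ t in (0 : ℝ)..ω, ‖ψ t‖ ^ 2 :=
      intervalIntegral.integral_pos hω (by fun_prop) (fun t _ => by positivity)
        ⟨t, ht, by positivity⟩
    exact this.ne' h2
  have h4 : ∀ x, ψ x = 0 := fun x => by
    have hp : Function.Periodic (fun x => ‖ψ x‖) ω := fun x => by simp [hψρ, hρ1]
    obtain ⟨y, hy, hxy⟩ := hp.exists_mem_Ico₀ hω x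
    simp only [h3 y ⟨hy.1, hy.2.le⟩, norm_zero, norm_eq_zero] at hxy
    exact hxy
  exact hψ0 (funext h4)

/-! ### The Green function and the resolvent -/

/-- Young's inequality `‖k * g‖₂ ≤ ‖k‖₁ ‖g‖₂` for nonnegative functions. -/
theorem lintegral_convolution_sq_le {k g : ℝ → ENNReal} (hk : Measurable k)
    (hg : AEMeasurable g) :
    ∫⁻ x, (∫⁻ t, k (x - t) * g t) ^ 2 ≤ (∫⁻ s, k s) ^ 2 * ∫⁻ t, g t ^ 2 := by
  set N := ∫⁻ s, k s with hN
  have hkx : ∀ x, Measurable fun t => k (x - t) := fun x => by fun_prop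
  have h1 : ∀ x, (∫⁻ t, k (x - t) * g t) ^ 2 ≤ N * ∫⁻ t, k (x - t) * g t ^ 2 := by
    intro x
    -- Cauchy-Schwarz for `k ^ (1 / 2)` and `(k g²) ^ (1 / 2)`.
    have h := ENNReal.lintegral_mul_norm_pow_le (μ := volume) (f := fun t => k (x - t))
      (g := fun t => k (x - t) * g t ^ 2) (hkx x).aemeasurable
      ((hkx x).aemeasurable.mul (hg.pow_const 2)) (p := 1 / 2) (q := 1 / 2) (by norm_num)
      (by norm_num) (by norm_num)
    rw [lintegral_sub_left_eq_self k x] at h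
    have e : ∀ t, k (x - t) ^ (1 / 2 : ℝ) * (k (x - t) * g t ^ 2) ^ (1 / 2 : ℝ)
        = k (x - t) * g t := fun t => by
      rw [ENNReal.mul_rpow_of_nonneg _ _ (by norm_num), ← mul_assoc,
        ← ENNReal.rpow_add_of_nonneg _ _ (by norm_num) (by norm_num), ← ENNReal.rpow_natCast,
        ← ENNReal.rpow_mul]
      norm_num
    simp only [e] at h
    calc (∫⁻ t, k (x - t) * g t) ^ 2
        ≤ (N ^ (1 / 2 : ℝ) * (∫⁻ t, k (x - t) * g t ^ 2) ^ (1 / 2 : ℝ)) ^ 2 := by gcongr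
      _ = N * ∫⁻ t, k (x - t) * g t ^ 2 := by
        rw [mul_pow, ← ENNReal.rpow_natCast, ← ENNReal.rpow_natCast, ← ENNReal.rpow_mul,
          ← ENNReal.rpow_mul]
        norm_num
  have hm : AEMeasurable (Function.uncurry fun x t => k (x - t) * g t ^ 2)
      ((volume : Measure ℝ).prod volume) := by
    refine AEMeasurable.mul (by fun_prop) ?_
    exact (hg.pow_const 2).comp_snd
  calc ∫⁻ x, (∫⁻ t, k (x - t) * g t) ^ 2
      ≤ ∫⁻ x, N * ∫⁻ t, k (x - t) * g t ^ 2 := lintegral_mono h1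
    _ = N * ∫⁻ x, ∫⁻ t, k (x - t) * g t ^ 2 := lintegral_const_mul'' _ hm.lintegral_prod_right'
    _ = N * ∫⁻ t, ∫⁻ x, k (x - t) * g t ^ 2 := by rw [lintegral_lintegral_swap hm]
    _ = N * ∫⁻ t, N * g t ^ 2 := by
      congr 1
      refine lintegral_congr fun t => ?_
      rw [lintegral_mul_const _ (by fun_prop), lintegral_sub_right_eq_self k t]
    _ = N ^ 2 * ∫⁻ t, g t ^ 2 := by
      rw [lintegral_const_mul'' _ (hg.pow_const 2), ← mul_assoc, sq]

theorem lintegral_exp_neg_mul_abs_lt_top {κ : ℝ} (hκ : 0 < κ) (B : ℝ) :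
    ∫⁻ s, ENNReal.ofReal (B * Real.exp (-(κ * |s|))) < ⊤ := by
  have h : Integrable fun s : ℝ => B * Real.exp (-(κ * |s|)) := by
    refine Integrable.const_mul ?_ B
    rw [← integrableOn_univ, ← Iic_union_Ioi (a := (0 : ℝ))]
    refine IntegrableOn.union ?_ ?_
    · refine (integrableOn_exp_mul_Iic hκ 0).congr_fun (fun s hs => ?_) measurableSet_Iic
      simp only [abs_of_nonpos (mem_Iic.1 hs)]
      ring_nf
    · refine (integrableOn_exp_mul_Ioi (neg_lt_zero.2 hκ) 0).congr_fun (fun s hs => ?_)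
        measurableSet_Ioi
      simp only [abs_of_pos (mem_Ioi.1 hs)]
      ring_nf
  exact (lintegral_ofReal_le_lintegral_enorm _).trans_lt h.2

/-- Two solutions with Wronskian `1`, decaying exponentially at `+∞` and at `-∞` respectively. -/
structure IsDecayingPair (V : ℝ → ℂ) (E : ℂ) (C κ : ℝ) (ψp ψm : ℝ → ℂ) : Prop where
  solution_right : IsSolution V E ψp
  solution_left : IsSolution V E ψm
  wronskian_eq_one : ∀ x, wronskian ψp ψm x = 1
  pos : 0 < κ
  nonneg : 0 ≤ C
  norm_right_le : ∀ x, ‖ψp x‖ ≤ C * Real.exp (-(κ * x))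
  norm_left_le : ∀ x, ‖ψm x‖ ≤ C * Real.exp (κ * x)
  norm_deriv_right_le : ∀ x, ‖deriv ψp x‖ ≤ C * Real.exp (-(κ * x))
  norm_deriv_left_le : ∀ x, ‖deriv ψm x‖ ≤ C * Real.exp (κ * x)

/-- The integral operator whose kernel is the Green function `ψp (max x t) * ψm (min x t)`. -/
def green (ψp ψm g : ℝ → ℂ) (x : ℝ) : ℂ :=
  ψp x * (∫ t in Iic x, ψm t * g t) + ψm x * ∫ t in Ioi x, ψp t * g t

theorem green_congr_ae (ψp ψm : ℝ → ℂ) {g h : ℝ → ℂ} (hgh : g =ᵐ[volume] h) :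
    green ψp ψm g = green ψp ψm h := by
  funext x
  have e : ∀ (ψ : ℝ → ℂ) (s : Set ℝ), ∫ t in s, ψ t * g t = ∫ t in s, ψ t * h t := fun ψ s =>
    integral_congr_ae (ae_restrict_of_ae (by filter_upwards [hgh] with t ht; rw [ht]))
  simp only [green, e]

theorem green_smul (ψp ψm : ℝ → ℂ) (c : ℂ) (g : ℝ → ℂ) :
    green ψp ψm (c • g) = c • green ψp ψm g := by
  funext x
  have e : ∀ (ψ : ℝ → ℂ) (s : Set ℝ), ∫ t in s, ψ t * (c * g t) = c * ∫ t in s, ψ t * g t :=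
    fun ψ s => by
      rw [← integral_const_mul]
      refine integral_congr_ae (ae_of_all _ fun t => ?_)
      ring
  simp only [green, Pi.smul_apply, smul_eq_mul, e]
  ring

namespace IsDecayingPair

variable {V : ℝ → ℂ} {E : ℂ} {C κ : ℝ} {ψp ψm : ℝ → ℂ} (h : IsDecayingPair V E C κ ψp ψm)
include h

theorem continuous_right : Continuous ψp := h.solution_right.acLocTwo.differentiable.continuous

theorem continuous_left : Continuous ψm := h.solution_left.acLocTwo.differentiable.continuous

theorem memLp_right (x : ℝ) : MemLp ψp 2 (volume.restrict (Ioi x)) := by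
  rw [memLp_two_iff_integrable_sq_norm h.continuous_right.aestronglyMeasurable]
  refine Integrable.mono' ((integrableOn_exp_mul_Ioi (a := -(2 * κ))
    (by linarith [h.pos]) x).const_mul (C ^ 2))
    (h.continuous_right.norm.pow 2).aestronglyMeasurable (ae_of_all _ fun t => ?_)
  have e : C ^ 2 * Real.exp (-(2 * κ) * t) = (C * Real.exp (-(κ * t))) ^ 2 := by
    rw [mul_pow, ← Real.exp_nat_mul]
    push_cast
    ring_nf
  rw [e, norm_pow, norm_norm]
  gcongr
  exact h.norm_right_le t

theorem memLp_left (x : ℝ) : MemLp ψm 2 (volume.restrict (Iic x)) := by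
  rw [memLp_two_iff_integrable_sq_norm h.continuous_left.aestronglyMeasurable]
  refine Integrable.mono' ((integrableOn_exp_mul_Iic (a := 2 * κ)
    (by linarith [h.pos]) x).const_mul (C ^ 2))
    (h.continuous_left.norm.pow 2).aestronglyMeasurable (ae_of_all _ fun t => ?_)
  have e : C ^ 2 * Real.exp (2 * κ * t) = (C * Real.exp (κ * t)) ^ 2 := by
    rw [mul_pow, ← Real.exp_nat_mul]
    push_cast
    ring_nf
  rw [e, norm_pow, norm_norm]
  gcongr
  exact h.norm_left_le t

section

variable {g : ℝ → ℂ} (hg : MemLp g 2 volume)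
include hg

theorem integrableOn_right (x : ℝ) : IntegrableOn (fun t => ψp t * g t) (Ioi x) :=
  (h.memLp_right x).integrable_mul (hg.restrict _)

theorem integrableOn_left (x : ℝ) : IntegrableOn (fun t => ψm t * g t) (Iic x) :=
  (h.memLp_left x).integrable_mul (hg.restrict _)

theorem hasACDeriv_integral_left :
    HasACDeriv (fun x => ∫ t in Iic x, ψm t * g t) (fun x => ψm x * g x) := by
  have hl : LocallyIntegrable fun t => ψm t * g t := fun x =>
    ⟨Iic (x + 1), Iic_mem_nhds (by linarith), h.integrableOn_left hg _⟩
  have := (hasACDeriv_const (∫ t in Iic (0 : ℝ), ψm t * g t)).add (hasACDeriv_integral hl 0)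
  simp only [zero_add] at this
  convert this using 2 with x
  rw [← intervalIntegral.integral_Iic_sub_Iic (h.integrableOn_left hg _)
    (h.integrableOn_left hg _)]
  ring

theorem hasACDeriv_integral_right :
    HasACDeriv (fun x => ∫ t in Ioi x, ψp t * g t) (fun x => -(ψp x * g x)) := by
  have hl : LocallyIntegrable fun t => ψp t * g t := fun x =>
    ⟨Ioi (x - 1), Ioi_mem_nhds (by linarith), h.integrableOn_right hg _⟩
  have := (hasACDeriv_const (∫ t in Ioi (0 : ℝ), ψp t * g t)).sub (hasACDeriv_integral hl 0)
  simp only [zero_sub] at this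
  convert this using 2 with x
  rw [← intervalIntegral.integral_Ioi_sub_Ioi' (h.integrableOn_right hg _)
    (h.integrableOn_right hg _)]
  ring

/-- Variation of constants: the derivative of `green ψp ψm g` is obtained by differentiating the
two solutions only. -/
theorem acLocTwo_green : ACLocTwo (green ψp ψm g) ∧
    ∀ᵐ x, diffExpr V (green ψp ψm g) x - E * green ψp ψm g x = g x := by
  have hA := h.hasACDeriv_integral_left hg
  have hB := h.hasACDeriv_integral_right hg
  set A := fun x => ∫ t in Iic x, ψm t * g t
  set B := fun x => ∫ t in Ioi x, ψp t * g t
  have hp := h.solution_right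
  have hm := h.solution_left
  have hcA := hA.acLoc.continuous
  have hcB := hB.acLoc.continuous
  have hcp := hp.acLocTwo.continuous_deriv
  have hcm := hm.acLocTwo.continuous_deriv
  have h1 : HasACDeriv (green ψp ψm g) fun x => deriv ψp x * A x + deriv ψm x * B x := by
    refine ((hp.acLocTwo.hasACDeriv.mul hA).add (hm.acLocTwo.hasACDeriv.mul hB)).congr_ae
      (Eventually.of_forall fun x => ?_)
    simp only
    ring
  have h2 : ∀ x, HasDerivAt (green ψp ψm g) (deriv ψp x * A x + deriv ψm x * B x) x :=
    h1.hasDerivAt (by fun_prop)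
  have h3 : HasACDeriv (fun x => deriv ψp x * A x + deriv ψm x * B x)
      fun x => (V x - E) * green ψp ψm g x - g x := by
    refine ((hp.hasACDeriv_deriv.mul hA).add (hm.hasACDeriv_deriv.mul hB)).congr_ae
      (Eventually.of_forall fun x => ?_)
    have hw := h.wronskian_eq_one x
    simp only [wronskian] at hw
    have hgr : green ψp ψm g x = ψp x * A x + ψm x * B x := rfl
    simp only [hgr]
    linear_combination -g x * hw
  refine ⟨acLocTwo_of_hasACDeriv h2 h3, ?_⟩
  have e : deriv (green ψp ψm g) = fun x => deriv ψp x * A x + deriv ψm x * B x :=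
    funext fun x => (h2 x).deriv
  filter_upwards [h3.deriv_ae_eq] with x hx
  rw [diffExpr, e, hx]
  ring

omit hg in
theorem enorm_green_le (x : ℝ) : ‖green ψp ψm g x‖ₑ
    ≤ ∫⁻ t, ENNReal.ofReal (C ^ 2 * Real.exp (-(κ * |x - t|))) * ‖g t‖ₑ := by
  have hC := h.nonneg
  rw [← lintegral_add_compl _ (measurableSet_Iic (a := x)), compl_Iic, green]
  refine (enorm_add_le _ _).trans (add_le_add ?_ ?_)
  · rw [← integral_const_mul]
    refine (enorm_integral_le_lintegral_enorm _).trans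
      (setLIntegral_mono' measurableSet_Iic fun t ht => ?_)
    rw [← mul_assoc, enorm_mul, ← ofReal_norm]
    gcongr
    rw [norm_mul]
    calc ‖ψp x‖ * ‖ψm t‖ ≤ (C * Real.exp (-(κ * x))) * (C * Real.exp (κ * t)) := by
          have := h.norm_right_le x
          have := h.norm_left_le t
          gcongr
      _ = C ^ 2 * Real.exp (-(κ * |x - t|)) := by
          rw [abs_of_nonneg (sub_nonneg.2 ht), mul_mul_mul_comm, ← Real.exp_add]
          ring_nf
  · rw [← integral_const_mul]
    refine (enorm_integral_le_lintegral_enorm _).trans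
      (setLIntegral_mono' measurableSet_Ioi fun t ht => ?_)
    rw [← mul_assoc, enorm_mul, ← ofReal_norm]
    gcongr
    rw [norm_mul]
    calc ‖ψm x‖ * ‖ψp t‖ ≤ (C * Real.exp (κ * x)) * (C * Real.exp (-(κ * t))) := by
          have := h.norm_left_le x
          have := h.norm_right_le t
          gcongr
      _ = C ^ 2 * Real.exp (-(κ * |x - t|)) := by
          rw [abs_of_neg (sub_neg.2 ht), mul_mul_mul_comm, ← Real.exp_add]
          ring_nf

theorem eLpNorm_green_le : eLpNorm (green ψp ψm g) 2 volume
    ≤ (∫⁻ s, ENNReal.ofReal (C ^ 2 * Real.exp (-(κ * |s|)))) * eLpNorm g 2 volume := by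
  have e : ∀ f : ℝ → ℂ, eLpNorm f 2 volume ^ 2 = ∫⁻ x, ‖f x‖ₑ ^ 2 := fun f => by
    have := eLpNorm_nnreal_pow_eq_lintegral (μ := volume) (f := f) (p := 2) (by norm_num)
    simpa using this
  rw [← ENNReal.pow_le_pow_left_iff two_ne_zero, mul_pow, e, e]
  refine le_trans (lintegral_mono fun x => ?_) (lintegral_convolution_sq_le
    (k := fun s => ENNReal.ofReal (C ^ 2 * Real.exp (-(κ * |s|)))) (by fun_prop)
    hg.1.enorm)
  gcongr
  exact h.enorm_green_le x

theorem memLp_green : MemLp (green ψp ψm g) 2 volume :=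
  ⟨(h.acLocTwo_green hg).1.differentiable.continuous.aestronglyMeasurable,
    (h.eLpNorm_green_le hg).trans_lt
      (ENNReal.mul_lt_top (lintegral_exp_neg_mul_abs_lt_top h.pos _) hg.2)⟩

theorem green_add {g' : ℝ → ℂ} (hg' : MemLp g' 2 volume) :
    green ψp ψm (g + g') = green ψp ψm g + green ψp ψm g' := by
  funext x
  simp only [green, Pi.add_apply, mul_add]
  rw [integral_add (h.integrableOn_left hg x) (h.integrableOn_left hg' x),
    integral_add (h.integrableOn_right hg x) (h.integrableOn_right hg' x)]
  ring

end

/-- The Green operator as a bounded operator on `L²(ℝ)`. -/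
def greenCLM : L2 →L[ℂ] L2 :=
  LinearMap.mkContinuous
    { toFun := fun y => (h.memLp_green (Lp.memLp y)).toLp
      map_add' := fun y z => by
        rw [← MemLp.toLp_add, MemLp.toLp_eq_toLp_iff, green_congr_ae ψp ψm (Lp.coeFn_add y z),
          h.green_add (Lp.memLp y) (Lp.memLp z)]
      map_smul' := fun c y => by
        rw [RingHom.id_apply, ← MemLp.toLp_const_smul, MemLp.toLp_eq_toLp_iff,
          green_congr_ae ψp ψm (Lp.coeFn_smul c y), green_smul] }
    (∫⁻ s, ENNReal.ofReal (C ^ 2 * Real.exp (-(κ * |s|)))).toReal fun y => by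
      rw [Lp.norm_def y, ← ENNReal.toReal_mul]
      refine (Lp.norm_toLp _ (h.memLp_green (Lp.memLp y))).trans_le
        (ENNReal.toReal_mono ?_ (h.eLpNorm_green_le (Lp.memLp y)))
      exact (ENNReal.mul_lt_top (lintegral_exp_neg_mul_abs_lt_top h.pos _) (Lp.memLp y).2).ne

theorem isDomRep_greenCLM (y : L2) : IsDomRep V (h.greenCLM y) (green ψp ψm y) where
  ae_eq := MemLp.coeFn_toLp (h.memLp_green (Lp.memLp y))
  acLocTwo := (h.acLocTwo_green (Lp.memLp y)).1
  memLp := by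
    have h1 := (Lp.memLp y).add ((h.memLp_green (Lp.memLp y)).const_mul E)
    refine (memLp_congr_ae ?_).1 h1
    filter_upwards [(h.acLocTwo_green (Lp.memLp y)).2] with x hx
    simp only [Pi.add_apply, ← hx]
    ring

/-- `H - E` is injective: the Wronskians of an `L²` solution with both decaying solutions
vanish. -/
theorem eq_zero_of_isSolution {f : ℝ → ℂ} (hf : IsSolution V E f) (hfL : MemLp f 2 volume) :
    f = 0 := by
  have hκ := h.pos
  have hC := h.nonneg
  have h1 : wronskian f ψp 0 = 0 := by
    refine wronskian_eq_zero_Ici hf.acLocTwo hfL h.solution_right.acLocTwo (a := 0) (C := C)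
      (fun x hx => ?_) (fun x hx => ?_) fun x _ => hf.wronskian_eq h.solution_right x 0
    · refine (h.norm_right_le x).trans (mul_le_of_le_one_right hC (Real.exp_le_one_iff.2 ?_))
      exact neg_nonpos.2 (by positivity)
    · refine (h.norm_deriv_right_le x).trans (mul_le_of_le_one_right hC (Real.exp_le_one_iff.2 ?_))
      exact neg_nonpos.2 (by positivity)
  have h2 : wronskian f ψm 0 = 0 := by
    refine wronskian_eq_zero_Iic hf.acLocTwo hfL h.solution_left.acLocTwo (a := 0) (C := C)
      (fun x hx => ?_) (fun x hx => ?_) fun x _ => hf.wronskian_eq h.solution_left x 0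
    · refine (h.norm_left_le x).trans (mul_le_of_le_one_right hC (Real.exp_le_one_iff.2 ?_))
      exact mul_nonpos_of_nonneg_of_nonpos hκ.le hx
    · refine (h.norm_deriv_left_le x).trans (mul_le_of_le_one_right hC (Real.exp_le_one_iff.2 ?_))
      exact mul_nonpos_of_nonneg_of_nonpos hκ.le hx
  funext x
  have h3 := wronskian_cramer f ψp ψm x
  rw [h.wronskian_eq_one, hf.wronskian_eq h.solution_left x 0,
    hf.wronskian_eq h.solution_right x 0, h1, h2] at h3
  simpa using h3

theorem mem_resolventSet : E ∈ resolventSet (hillOperator V) := by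
  have key : ∀ y : L2, ∃ hy : h.greenCLM y ∈ (hillOperator V).domain,
      hillOperator V ⟨h.greenCLM y, hy⟩ - E • h.greenCLM y = y := fun y => by
    have hr := h.isDomRep_greenCLM y
    refine ⟨⟨_, hr⟩, Lp.ext ?_⟩
    filter_upwards [hillOperator_sub_smul_ae E ⟨h.greenCLM y, ⟨_, hr⟩⟩ hr,
      (h.acLocTwo_green (Lp.memLp y)).2] with x h1 h2
    rw [h1, h2]
  refine ⟨h.greenCLM, key, fun f => ?_⟩
  obtain ⟨hd, he⟩ := key (hillOperator V f - E • (f : L2))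
  set d : (hillOperator V).domain := ⟨_, hd⟩ - f with hdef
  have hd0 : hillOperator V d - E • (d : L2) = 0 := by
    rw [hdef, LinearPMap.map_sub, Submodule.coe_sub, smul_sub]
    rw [← sub_eq_zero] at he
    rw [← he]
    abel
  have hrep := isDomRep_domRep V d
  have hsol : IsSolution V E (domRep V d) := ⟨hrep.acLocTwo, by
    have h1 := hillOperator_sub_smul_ae E d hrep
    rw [hd0] at h1
    filter_upwards [h1, Lp.coeFn_zero ℂ 2 (volume : Measure ℝ)] with x h2 h3
    rw [h3, Pi.zero_apply] at h2
    exact (sub_eq_zero.1 h2.symm)⟩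
  have h0 := h.eq_zero_of_isSolution hsol hrep.memLp_two
  have hdz : (d : L2) = 0 := by
    refine Lp.ext ?_
    have := hrep.ae_eq
    rw [h0] at this
    exact this.trans (Lp.coeFn_zero ℂ 2 (volume : Measure ℝ)).symm
  rw [hdef, Submodule.coe_sub, sub_eq_zero] at hdz
  exact hdz

end IsDecayingPair

/-! ### The spectrum in terms of the discriminant -/

/-- Floquet solutions with different multipliers are linearly independent. -/
theorem wronskian_floquet_ne_zero {V : ℝ → ℂ} (hV : LocallyIntegrable V) {E ρ σ : ℂ} {ω : ℝ}
    (hρσ : ρ ≠ σ) {ψ χ : ℝ → ℂ} (hψ : IsSolution V E ψ) (hχ : IsSolution V E χ) (hψ0 : ψ ≠ 0)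
    (hχ0 : χ ≠ 0) (hψρ : ∀ x, ψ (x + ω) = ρ * ψ x) (hχσ : ∀ x, χ (x + ω) = σ * χ x) :
    wronskian ψ χ 0 ≠ 0 := by
  intro hw
  have key : ∀ {a b : ℂ}, a ≠ 0 → (∀ x, a * χ x = b * ψ x) → False := fun {a b} ha hab => by
    refine hχ0 (funext fun x => ?_)
    have h1 := hab (x + ω)
    rw [hψρ, hχσ] at h1
    have h2 : a * (σ - ρ) * χ x = 0 := by linear_combination h1 - ρ * hab x
    simpa [ha, sub_eq_zero, hρσ.symm] using h2
  have hc : ∀ f, IsSolution V E f → ∀ x, wronskian f ψ 0 * χ x = wronskian f χ 0 * ψ x :=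
    fun f hf x => by
      have := wronskian_cramer f ψ χ x
      rw [hψ.wronskian_eq hχ x 0, hw, hf.wronskian_eq hψ x 0, hf.wronskian_eq hχ x 0] at this
      linear_combination this
  by_cases h0 : ψ 0 = 0
  · have h1 : deriv ψ 0 ≠ 0 := fun h1 => hψ0 (by
      rw [hψ.eq_phi hV, h0, h1, zero_smul, zero_smul, add_zero])
    refine key (a := wronskian (phi₁ V E) ψ 0) ?_ (hc _ (isSolution_phi₁ hV E))
    simpa [wronskian, phi₁_zero hV, deriv_phi₁_zero hV] using h1
  · refine key (a := wronskian (phi₂ V E) ψ 0) ?_ (hc _ (isSolution_phi₂ hV E))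
    simpa [wronskian, phi₂_zero hV, deriv_phi₂_zero hV] using h0

theorem exists_isDecayingPair {V : ℝ → ℂ} (hV : LocallyIntegrable V) {ω : ℝ} (hω : 0 < ω)
    (hper : Function.Periodic V ω) {E ρ : ℂ} (hρ0 : ρ ≠ 0) (hρ1 : ‖ρ‖ < 1)
    (hρ : ρ ^ 2 - 2 * discriminant V ω E * ρ + 1 = 0) :
    ∃ C κ ψp ψm, IsDecayingPair V E C κ ψp ψm := by
  have hρ' : ρ⁻¹ ^ 2 - 2 * discriminant V ω E * ρ⁻¹ + 1 = 0 := by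
    field_simp
    linear_combination hρ
  have hne : ρ ≠ ρ⁻¹ := fun h => by
    have h1 : ‖ρ‖ = ‖ρ‖⁻¹ := by rw [← norm_inv, ← h]
    have h2 := (one_lt_inv₀ (norm_pos_iff.2 hρ0)).2 hρ1
    linarith
  obtain ⟨ψ, hψ, hψ0, hψρ⟩ := exists_floquet_solution hV hper hρ
  obtain ⟨χ, hχ, hχ0, hχρ⟩ := exists_floquet_solution hV hper hρ'
  set w := wronskian ψ χ 0 with hw
  have hw0 : w ≠ 0 := wronskian_floquet_ne_zero hV hne hψ hχ hψ0 hχ0 hψρ hχρ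
  have hd : deriv (w⁻¹ • χ) = w⁻¹ • deriv χ := hχ.acLocTwo.deriv_smul w⁻¹
  have hχ' := hχ.smul w⁻¹
  have hχρ' : ∀ x, (w⁻¹ • χ) (x + ω) = ρ⁻¹ * (w⁻¹ • χ) x := fun x => by
    simp only [Pi.smul_apply, hχρ, smul_eq_mul]
    ring
  have hinv : ρ⁻¹ ≠ 0 := inv_ne_zero hρ0
  obtain ⟨C₁, n₁, h₁⟩ := norm_floquet_le hψ.acLocTwo.differentiable.continuous hω hρ0 hψρ
  obtain ⟨C₂, n₂, h₂⟩ := norm_floquet_le hψ.acLocTwo.continuous_deriv hω hρ0 (deriv_floquet hψρ)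
  obtain ⟨C₃, n₃, h₃⟩ := norm_floquet_le hχ'.acLocTwo.differentiable.continuous hω hinv hχρ'
  obtain ⟨C₄, n₄, h₄⟩ := norm_floquet_le hχ'.acLocTwo.continuous_deriv hω hinv
    (deriv_floquet hχρ')
  have hκ : ∀ x, Real.log ‖ρ‖ / ω * x = -(-Real.log ‖ρ‖ / ω * x) := fun x => by ring
  have hκ' : Real.log ‖ρ⁻¹‖ = -Real.log ‖ρ‖ := by rw [norm_inv, Real.log_inv]
  simp only [hκ', hκ] at h₁ h₂ h₃ h₄
  have hle : ∀ {a b c d : ℝ}, a ≤ b * Real.exp d → b ≤ c → a ≤ c * Real.exp d := fun h h' =>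
    h.trans (mul_le_mul_of_nonneg_right h' (Real.exp_pos _).le)
  refine ⟨C₁ + C₂ + C₃ + C₄, -Real.log ‖ρ‖ / ω, ψ, w⁻¹ • χ, hψ, hχ', fun x => ?_,
    div_pos (neg_pos.2 (Real.log_neg (norm_pos_iff.2 hρ0) hρ1)) hω, by positivity,
    fun x => hle (h₁ x) (by linarith), fun x => hle (h₃ x) (by linarith),
    fun x => hle (h₂ x) (by linarith), fun x => hle (h₄ x) (by linarith)⟩
  have hsmul : wronskian ψ (w⁻¹ • χ) 0 = w⁻¹ * w := by
    rw [wronskian, hd, Pi.smul_apply, Pi.smul_apply, smul_eq_mul, smul_eq_mul,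
      show w = ψ 0 * deriv χ 0 - deriv ψ 0 * χ 0 from hw]
    ring
  rw [hψ.wronskian_eq hχ' x 0, hsmul, inv_mul_cancel₀ hw0]

/-- The spectrum of the Hill operator is the set where the Floquet discriminant takes values
in `[-1, 1]`, i.e. where the Floquet multipliers are unimodular. -/
theorem mem_spectrumSet_iff {V : ℝ → ℂ} {ω : ℝ} (hω : 0 < ω) (hV : LocallyIntegrable V)
    (hper : Function.Periodic V ω) (E : ℂ) :
    E ∈ spectrumSet (hillOperator V) ↔ ∃ r : ℝ, -1 ≤ r ∧ r ≤ 1 ∧ discriminant V ω E = r := by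
  constructor
  · intro hE
    obtain ⟨s, hs⟩ := IsAlgClosed.exists_pow_nat_eq (discriminant V ω E ^ 2 - 1) two_pos
    set ρ := discriminant V ω E + s with hρdef
    have hρ : ρ ^ 2 - 2 * discriminant V ω E * ρ + 1 = 0 := by
      rw [hρdef]; linear_combination hs
    have hρ0 : ρ ≠ 0 := fun h => by simp [h] at hρ
    have hΔ : discriminant V ω E = (ρ + ρ⁻¹) / 2 := by
      field_simp
      linear_combination -hρ
    rcases lt_trichotomy ‖ρ‖ 1 with h | h | h
    · obtain ⟨C, κ, ψp, ψm, hp⟩ := exists_isDecayingPair hV hω hper hρ0 h hρ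
      exact absurd hp.mem_resolventSet hE
    · have h1 := Complex.abs_re_le_norm ρ
      rw [h, abs_le] at h1
      refine ⟨ρ.re, h1.1, h1.2, ?_⟩
      rw [hΔ, Complex.inv_eq_conj h, Complex.add_conj]
      push_cast
      ring
    · have hρ' : ρ⁻¹ ^ 2 - 2 * discriminant V ω E * ρ⁻¹ + 1 = 0 := by
        field_simp
        linear_combination hρ
      obtain ⟨C, κ, ψp, ψm, hp⟩ := exists_isDecayingPair hV hω hper (inv_ne_zero hρ0)
        (by rw [norm_inv]; exact inv_lt_one_of_one_lt₀ h) hρ'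
      exact absurd hp.mem_resolventSet hE
  · rintro ⟨r, hr1, hr2, hr⟩
    have h0 : 0 ≤ 1 - r ^ 2 := by nlinarith
    have hsq := Real.sq_sqrt h0
    generalize √(1 - r ^ 2) = s at hsq
    refine mem_spectrumSet_of_norm_eq_one hω hV hper (ρ := ⟨r, s⟩) ?_ ?_
    · rw [hr]
      apply Complex.ext <;> simp [pow_two] <;> nlinarith
    · rw [Complex.norm_def, Complex.normSq_mk, ← sq, ← sq, hsq]
      simp

/-! ### Local normal form of a holomorphic function -/

/-- `ζ` is a holomorphic chart, defined on the disc of radius `ε` about `0` and centred at `z₀`. -/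
structure IsHolomorphicChart (z₀ : ℂ) (ε : ℝ) (ζ : ℂ → ℂ) : Prop where
  pos : 0 < ε
  analytic : AnalyticOnNhd ℂ ζ (Metric.ball 0 ε)
  injOn : InjOn ζ (Metric.ball 0 ε)
  deriv_ne_zero : ∀ w ∈ Metric.ball 0 ε, deriv ζ w ≠ 0
  map_zero : ζ 0 = z₀
  isOpen_image : ∀ δ ≤ ε, IsOpen (ζ '' Metric.ball 0 δ)

theorem exists_isHolomorphicChart_of_deriv_ne_zero {h : ℂ → ℂ} {z₀ : ℂ} (hh : AnalyticAt ℂ h z₀)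
    (h0 : h z₀ = 0) (h1 : deriv h z₀ ≠ 0) {p : ℂ → Prop} (hp : ∀ᶠ z in 𝓝 z₀, p z) :
    ∃ ε ζ, IsHolomorphicChart z₀ ε ζ ∧ ∀ w ∈ Metric.ball 0 ε, h (ζ w) = w ∧ p (ζ w) := by
  have hs := hh.hasStrictDerivAt
  set R := (hs.hasStrictFDerivAt_equiv h1).toOpenPartialHomeomorph h with hR
  have hz : z₀ ∈ R.source :=
    (hs.hasStrictFDerivAt_equiv h1).mem_toOpenPartialHomeomorph_source
  have hRh : ∀ z, R z = h z := fun z => rfl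
  have h0t : (0 : ℂ) ∈ R.target := by
    have := R.map_source hz
    rwa [hRh, h0] at this
  have hsymm0 : R.symm 0 = z₀ := by
    have := R.left_inv hz
    rwa [hRh, h0] at this
  have hev : ∀ᶠ z in 𝓝 z₀, p z ∧ AnalyticAt ℂ h z ∧ deriv h z ≠ 0 :=
    hp.and (hh.eventually_analyticAt.and (hh.deriv.continuousAt.eventually_ne h1))
  have hcont : Tendsto R.symm (𝓝 0) (𝓝 z₀) := by
    have := R.continuousAt_symm h0t
    rwa [ContinuousAt, hsymm0] at this
  obtain ⟨ε, hε, hball⟩ := Metric.eventually_nhds_iff_ball.1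
    ((hcont.eventually hev).and (R.open_target.mem_nhds h0t))
  have hd : ∀ w ∈ Metric.ball (0 : ℂ) ε, HasDerivAt R.symm (deriv h (R.symm w))⁻¹ w := fun w hw =>
    R.hasDerivAt_symm (hball w hw).2 (hball w hw).1.2.2
      (hball w hw).1.2.1.differentiableAt.hasDerivAt
  have hsub : Metric.ball (0 : ℂ) ε ⊆ R.symm.source := fun w hw => (hball w hw).2
  refine ⟨ε, R.symm, ⟨hε, ?_, R.symm.injOn.mono hsub, fun w hw => ?_, hsymm0, fun δ hδ => ?_⟩,
    fun w hw => ⟨R.right_inv (hball w hw).2, (hball w hw).1.1⟩⟩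
  · exact DifferentiableOn.analyticOnNhd
      (fun w hw => (hd w hw).differentiableAt.differentiableWithinAt) Metric.isOpen_ball
  · rw [(hd w hw).deriv]
    exact inv_ne_zero (hball w hw).1.2.2
  · exact R.symm.isOpen_image_of_subset_source Metric.isOpen_ball
      ((Metric.ball_subset_ball hδ).trans hsub)

/-- A holomorphic function with first nonvanishing derivative of order `k` is, up to a constant, the
`k`-th power of a local coordinate. -/
theorem exists_pow_eq_of_iteratedDeriv {f : ℂ → ℂ} {z₀ : ℂ} (hf : AnalyticAt ℂ f z₀) {k : ℕ}
    (hk : k ≠ 0) (h0 : ∀ j, 1 ≤ j → j < k → iteratedDeriv j f z₀ = 0)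
    (h1 : iteratedDeriv k f z₀ ≠ 0) :
    ∃ h : ℂ → ℂ, AnalyticAt ℂ h z₀ ∧ h z₀ = 0 ∧ deriv h z₀ ≠ 0 ∧
      ∀ᶠ z in 𝓝 z₀, f z = f z₀ + h z ^ k := by
  have hF : AnalyticAt ℂ (fun z => f z - f z₀) z₀ := hf.sub analyticAt_const
  have hit : ∀ j, j ≠ 0 → iteratedDeriv j (fun z => f z - f z₀) z₀ = iteratedDeriv j f z₀ := by
    intro j hj
    rw [iteratedDeriv_fun_sub hf.contDiffAt contDiffAt_const, iteratedDeriv_const]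
    simp [hj]
  have hord : analyticOrderAt (fun z => f z - f z₀) z₀ = k := by
    refine le_antisymm ?_ ((natCast_le_analyticOrderAt_iff_iteratedDeriv_eq_zero hF).2 ?_)
    · by_contra! hlt
      have h2 : ((k + 1 : ℕ) : ℕ∞) ≤ analyticOrderAt (fun z => f z - f z₀) z₀ := by
        push_cast
        exact Order.add_one_le_of_lt hlt
      have h3 := (natCast_le_analyticOrderAt_iff_iteratedDeriv_eq_zero hF).1 h2 k (by omega)
      rw [hit k hk] at h3
      exact h1 h3
    · intro j hj
      rcases Nat.eq_zero_or_pos j with rfl | hj0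
      · simp
      · rw [hit j hj0.ne', h0 j hj0 hj]
  obtain ⟨g, hg, hg0, hfg⟩ := hF.analyticOrderAt_eq_natCast.1 hord
  obtain ⟨c, hc⟩ := IsAlgClosed.exists_pow_nat_eq (g z₀) (Nat.pos_of_ne_zero hk)
  have hc0 : c ≠ 0 := by
    rintro rfl
    rw [zero_pow hk] at hc
    exact hg0 hc.symm
  have hk' : (k : ℂ) ≠ 0 := by exact_mod_cast hk
  -- A holomorphic `k`-th root of `g` near `z₀`.
  set q : ℂ → ℂ := fun z => c * Complex.exp (Complex.log (g z / g z₀) / k) with hq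
  have hqa : AnalyticAt ℂ q z₀ := by
    have h2 : AnalyticAt ℂ (fun z => g z / g z₀) z₀ := hg.div analyticAt_const hg0
    have h3 : AnalyticAt ℂ (fun z => Complex.log (g z / g z₀)) z₀ :=
      h2.clog (by simp [div_self hg0])
    exact analyticAt_const.mul ((h3.div analyticAt_const hk').cexp)
  have hq0 : q z₀ = c := by simp [hq, div_self hg0]
  have hda : HasDerivAt (fun z => (z - z₀) * q z) c z₀ := by
    have := ((hasDerivAt_id z₀).sub_const z₀).mul hqa.differentiableAt.hasDerivAt
    simp only [id, sub_self, zero_mul, add_zero, one_mul, hq0] at this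
    exact this
  refine ⟨fun z => (z - z₀) * q z, (analyticAt_id.sub analyticAt_const).mul hqa, by simp, ?_, ?_⟩
  · rw [hda.deriv]; exact hc0
  · filter_upwards [hfg, hg.continuousAt.eventually_ne hg0] with z hz hgz
    have h2 : q z ^ k = g z := by
      rw [hq]
      simp only
      rw [mul_pow, hc, ← Complex.exp_nat_mul, mul_div_cancel₀ _ hk',
        Complex.exp_log (div_ne_zero hgz hg0), mul_div_cancel₀ _ hg0]
    rw [mul_pow, h2, ← smul_eq_mul, ← hz]
    ring

/-- In a suitable holomorphic chart, a holomorphic function whose first nonvanishing derivative has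
order `k` is `w ↦ f z₀ + w ^ k`. -/
theorem exists_isHolomorphicChart_pow {f : ℂ → ℂ} {z₀ : ℂ} (hf : AnalyticAt ℂ f z₀) {k : ℕ}
    (hk : k ≠ 0) (h0 : ∀ j, 1 ≤ j → j < k → iteratedDeriv j f z₀ = 0)
    (h1 : iteratedDeriv k f z₀ ≠ 0) :
    ∃ ε ζ, IsHolomorphicChart z₀ ε ζ ∧ ∀ w ∈ Metric.ball 0 ε, f (ζ w) = f z₀ + w ^ k := by
  obtain ⟨h, ha, hz, hd, hev⟩ := exists_pow_eq_of_iteratedDeriv hf hk h0 h1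
  obtain ⟨ε, ζ, hζ, hw⟩ := exists_isHolomorphicChart_of_deriv_ne_zero ha hz hd hev
  refine ⟨ε, ζ, hζ, fun w hwε => ?_⟩
  rw [(hw w hwε).2, (hw w hwε).1]

/-! ### Images of segments under a chart -/

theorem mul_mem_ball_of_mem_Icc {ε δ : ℝ} {u : ℂ} (hδ0 : 0 < δ) (hδ : δ < ε) (hu : ‖u‖ = 1) {t : ℝ}
    (ht : t ∈ Icc (-1) 1) : (t * (δ * u) : ℂ) ∈ Metric.ball (0 : ℂ) ε := by
  have : |t| ≤ 1 := abs_le.2 ht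
  rw [mem_ball_zero_iff, norm_mul, norm_mul, hu, Complex.norm_real, Complex.norm_real,
    Real.norm_of_nonneg hδ0.le, Real.norm_eq_abs]
  nlinarith

namespace IsHolomorphicChart

variable {z₀ : ℂ} {ε δ : ℝ} {ζ : ℂ → ℂ} (h : IsHolomorphicChart z₀ ε ζ) {u : ℂ}
include h

theorem hasDerivAt_segment (hδ0 : 0 < δ) (hδ : δ < ε) (hu : ‖u‖ = 1) {t : ℝ}
    (ht : t ∈ Icc (-1) 1) :
    HasDerivAt (fun t : ℝ => ζ (t * (δ * u))) (deriv ζ (t * (δ * u)) * (δ * u)) t := by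
  have h1 := (h.analytic _ (mul_mem_ball_of_mem_Icc hδ0 hδ hu ht)).differentiableAt.hasDerivAt
  have h2 : HasDerivAt (fun t : ℝ => (t * (δ * u) : ℂ)) (δ * u) t := by
    simpa using ((hasDerivAt_id t).ofReal_comp.mul_const (δ * u : ℂ))
  exact h1.comp t h2

theorem isAnalyticArc_segment (hδ0 : 0 < δ) (hδ : δ < ε) (hu : ‖u‖ = 1) :
    IsAnalyticArc (fun t : ℝ => ζ (t * (δ * u))) (-1) 1 where
  analytic := fun t ht => by
    have h1 := (h.analytic _ (mul_mem_ball_of_mem_Icc hδ0 hδ hu ht)).restrictScalars (𝕜 := ℝ)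
    have h2 : AnalyticAt ℝ (fun t : ℝ => (t * (δ * u) : ℂ)) t :=
      (Complex.ofRealCLM.analyticAt t).mul analyticAt_const
    exact AnalyticAt.comp (g := ζ) (f := fun t : ℝ => (t * (δ * u) : ℂ)) h1 h2
  injOn := fun s hs t ht hst => by
    have h1 := h.injOn (mul_mem_ball_of_mem_Icc hδ0 hδ hu hs)
      (mul_mem_ball_of_mem_Icc hδ0 hδ hu ht) hst
    have hu0 : u ≠ 0 := fun h0 => by simp [h0] at hu
    have h2 : (δ * u : ℂ) ≠ 0 := mul_ne_zero (by exact_mod_cast hδ0.ne') hu0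
    exact_mod_cast mul_right_cancel₀ h2 h1
  deriv_ne_zero := fun t ht => by
    have hu0 : u ≠ 0 := fun h0 => by simp [h0] at hu
    rw [(h.hasDerivAt_segment hδ0 hδ hu ht).deriv]
    exact mul_ne_zero (h.deriv_ne_zero _ (mul_mem_ball_of_mem_Icc hδ0 hδ hu ht))
      (mul_ne_zero (by exact_mod_cast hδ0.ne') hu0)

end IsHolomorphicChart

theorem IsAnalyticArc.mono {γ : ℝ → ℂ} {a b c d : ℝ} (h : IsAnalyticArc γ a b)
    (hsub : Icc c d ⊆ Icc a b) : IsAnalyticArc γ c d :=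
  ⟨h.analytic.mono hsub, h.injOn.mono hsub, fun t ht => h.deriv_ne_zero t (hsub ht)⟩

/-- If in a chart `S` is the set of real points, then `S` is an arc through the centre. -/
theorem IsHolomorphicChart.isArcThrough {z₀ : ℂ} {ε : ℝ} {ζ : ℂ → ℂ}
    (h : IsHolomorphicChart z₀ ε ζ) {S : Set ℂ} {δ : ℝ} (hδ0 : 0 < δ) (hδ : δ < ε)
    (hS : ∀ w, ‖w‖ < δ → (ζ w ∈ S ↔ ∃ s : ℝ, w = s)) : IsArcThrough S z₀ := by
  have harc := h.isAnalyticArc_segment hδ0 hδ (u := 1) (by simp)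
  refine ⟨_, harc, by simp [h.map_zero], ζ '' Metric.ball 0 δ, h.isOpen_image δ hδ.le,
    ⟨0, Metric.mem_ball_self hδ0, h.map_zero⟩, ?_⟩
  ext z
  constructor
  · rintro ⟨hzS, w, hw, rfl⟩
    rw [mem_ball_zero_iff] at hw
    obtain ⟨s, rfl⟩ := (hS w hw).1 hzS
    rw [Complex.norm_real, Real.norm_eq_abs, abs_lt] at hw
    refine ⟨s / δ, ⟨?_, ?_⟩, ?_⟩
    · rw [lt_div_iff₀ hδ0]; linarith
    · rw [div_lt_iff₀ hδ0]; linarith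
    · have : (δ : ℂ) ≠ 0 := by exact_mod_cast hδ0.ne'
      push_cast
      simp only [mul_one, div_mul_cancel₀ _ this]
  · rintro ⟨t, ht, rfl⟩
    have hn : ‖(t * (δ * 1) : ℂ)‖ < δ := by
      have : |t| < 1 := abs_lt.2 ht
      rw [mul_one, norm_mul, Complex.norm_real, Complex.norm_real, Real.norm_of_nonneg hδ0.le,
        Real.norm_eq_abs]
      nlinarith
    exact ⟨(hS _ hn).2 ⟨t * δ, by push_cast; ring⟩, _, mem_ball_zero_iff.2 hn, rfl⟩

/-- The direction `exp (i (θ + j 2π / n))` of the `j`-th of `n` equidistributed rays. -/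
def rayDir (n : ℕ) (θ : ℝ) (j : ℕ) : ℂ :=
  Complex.exp (((θ + j * (2 * Real.pi / n) : ℝ) : ℂ) * Complex.I)

theorem norm_rayDir (n : ℕ) (θ : ℝ) (j : ℕ) : ‖rayDir n θ j‖ = 1 :=
  Complex.norm_exp_ofReal_mul_I _

theorem rayDir_eq (n : ℕ) (θ : ℝ) (j : ℕ) : rayDir n θ j
    = Complex.exp (θ * Complex.I) * Complex.exp (2 * Real.pi * Complex.I / n) ^ j := by
  rw [rayDir, ← Complex.exp_nat_mul, ← Complex.exp_add]
  congr 1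
  push_cast
  ring

theorem rayDir_injOn {n : ℕ} (hn : n ≠ 0) (θ : ℝ) {i j : ℕ} (hi : i < n) (hj : j < n)
    (h : rayDir n θ i = rayDir n θ j) : i = j := by
  rw [rayDir_eq, rayDir_eq] at h
  exact (Complex.isPrimitiveRoot_exp n hn).pow_inj hi hj
    (mul_left_cancel₀ (Complex.exp_ne_zero _) h)

/-- The solutions of `c w ^ n ≥ 0` are the points of `n` equidistributed rays. -/
theorem exists_nonneg_eq_pow_iff {n : ℕ} (hn : n ≠ 0) {c : ℂ} {θ : ℝ}
    (hc : c * Complex.exp (θ * Complex.I) ^ n = 1) (w : ℂ) :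
    (∃ s : ℝ, 0 ≤ s ∧ c * w ^ n = s) ↔ ∃ j < n, w = ‖w‖ * rayDir n θ j := by
  have hprim := Complex.isPrimitiveRoot_exp n hn
  have hray : ∀ j, c * rayDir n θ j ^ n = 1 := fun j => by
    rw [rayDir_eq, mul_pow, ← mul_assoc, hc, ← pow_mul, mul_comm j, pow_mul, hprim.pow_eq_one,
      one_pow, one_mul]
  have hc1 : ‖c‖ = 1 := by
    have := congrArg norm hc
    simpa [Complex.norm_exp_ofReal_mul_I] using this
  constructor
  · rintro ⟨s, hs, hw⟩
    rcases eq_or_ne w 0 with rfl | hw0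
    · exact ⟨0, Nat.pos_of_ne_zero hn, by simp⟩
    have hnw : (‖w‖ : ℂ) ≠ 0 := by exact_mod_cast (norm_pos_iff.2 hw0).ne'
    have hs' : s = ‖w‖ ^ n := by
      have := congrArg norm hw
      rw [norm_mul, norm_pow, hc1, one_mul, Complex.norm_real, Real.norm_of_nonneg hs] at this
      exact this.symm
    have he := Complex.exp_ne_zero (θ * Complex.I)
    have h1 : (w / ‖w‖ / Complex.exp (θ * Complex.I)) ^ n = 1 := by
      rw [div_pow, div_pow, div_div, div_eq_one_iff_eq (mul_ne_zero (pow_ne_zero _ hnw)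
        (pow_ne_zero _ he))]
      have h2 : (s : ℂ) = (‖w‖ : ℂ) ^ n := by rw [hs']; push_cast; rfl
      rw [h2] at hw
      linear_combination (-(w ^ n)) * hc + Complex.exp (θ * Complex.I) ^ n * hw
    have : NeZero n := ⟨hn⟩
    obtain ⟨j, hj, hj'⟩ := hprim.eq_pow_of_pow_eq_one h1
    refine ⟨j, hj, ?_⟩
    rw [rayDir_eq, hj']
    field_simp
  · rintro ⟨j, -, hj⟩
    refine ⟨‖w‖ ^ n, by positivity, ?_⟩
    rw [hj, mul_pow, mul_left_comm, hray, norm_mul, norm_rayDir, Complex.norm_real, norm_norm]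
    push_cast
    ring

/-- If in a chart `S` is given by `c w ^ n ≥ 0`, then `S` is a star of `n` arcs. -/
theorem IsHolomorphicChart.isArcStar {z₀ : ℂ} {ε : ℝ} {ζ : ℂ → ℂ}
    (h : IsHolomorphicChart z₀ ε ζ) {S : Set ℂ} {n : ℕ} (hn : n ≠ 0) {c : ℂ} {θ : ℝ}
    (hc : c * Complex.exp (θ * Complex.I) ^ n = 1) {δ : ℝ} (hδ0 : 0 < δ) (hδ : δ < ε)
    (hS : ∀ w, ‖w‖ < δ → (ζ w ∈ S ↔ ∃ s : ℝ, 0 ≤ s ∧ c * w ^ n = s)) :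
    IsArcStar S z₀ n (2 * Real.pi / n) := by
  have hδc : (δ : ℂ) ≠ 0 := by exact_mod_cast hδ0.ne'
  have hsub : Icc (0 : ℝ) 1 ⊆ Icc (-1) 1 := Icc_subset_Icc (by norm_num) le_rfl
  have hnorm : ∀ j (t : ℝ), 0 ≤ t → ‖(t * (δ * rayDir n θ j) : ℂ)‖ = t * δ := fun j t ht => by
    rw [norm_mul, norm_mul, norm_rayDir, Complex.norm_real, Complex.norm_real,
      Real.norm_of_nonneg hδ0.le, Real.norm_of_nonneg ht, mul_one]
  refine ⟨fun j t => ζ (t * (δ * rayDir n θ j)), fun j =>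
    ⟨(h.isAnalyticArc_segment hδ0 hδ (norm_rayDir n θ j)).mono hsub, by simp [h.map_zero]⟩,
    fun i j hij => ?_, ⟨ζ '' Metric.ball 0 δ, h.isOpen_image δ hδ.le,
    ⟨0, Metric.mem_ball_self hδ0, h.map_zero⟩, ?_⟩, (deriv ζ 0).arg + θ, fun j => ?_⟩
  · ext z
    rw [mem_singleton_iff]
    constructor
    · rintro ⟨⟨s, hs, rfl⟩, t, ht, hst⟩
      have h1 := h.injOn (mul_mem_ball_of_mem_Icc hδ0 hδ (norm_rayDir n θ j) (hsub ht))
        (mul_mem_ball_of_mem_Icc hδ0 hδ (norm_rayDir n θ i) (hsub hs)) hst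
      have h2 := congrArg norm h1
      rw [hnorm j t ht.1, hnorm i s hs.1] at h2
      have h3 : t = s := mul_right_cancel₀ hδ0.ne' h2
      subst h3
      rcases eq_or_ne t 0 with rfl | ht0
      · simp [h.map_zero]
      · have ht0' : (t : ℂ) ≠ 0 := by exact_mod_cast ht0
        have h4 := mul_left_cancel₀ hδc (mul_left_cancel₀ ht0' h1)
        exact absurd (Fin.ext (rayDir_injOn hn θ i.2 j.2 h4.symm)) hij
    · rintro rfl
      exact ⟨⟨0, ⟨le_rfl, zero_le_one⟩, by simp [h.map_zero]⟩,
        ⟨0, ⟨le_rfl, zero_le_one⟩, by simp [h.map_zero]⟩⟩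
  · ext z
    rw [mem_iUnion]
    constructor
    · rintro ⟨hzS, w, hw, rfl⟩
      rw [mem_ball_zero_iff] at hw
      obtain ⟨j, hj, hwj⟩ := (exists_nonneg_eq_pow_iff hn hc w).1 ((hS w hw).1 hzS)
      refine ⟨⟨j, hj⟩, ‖w‖ / δ, ⟨by positivity, (div_lt_one hδ0).2 hw⟩, ?_⟩
      conv_rhs => rw [hwj]
      push_cast
      field_simp
    · rintro ⟨j, t, ht, rfl⟩
      have hlt : ‖(t * (δ * rayDir n θ j) : ℂ)‖ < δ := by
        rw [hnorm j t ht.1]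
        nlinarith [ht.2]
      refine ⟨(hS _ hlt).2 ((exists_nonneg_eq_pow_iff hn hc _).2 ⟨j, j.2, ?_⟩), _,
        mem_ball_zero_iff.2 hlt, rfl⟩
      rw [hnorm j t ht.1]
      push_cast
      ring
  · have hd := (h.hasDerivAt_segment hδ0 hδ (norm_rayDir n θ j) (t := 0) (by simp)).deriv
    simp only [Complex.ofReal_zero, zero_mul] at hd
    rw [hd, norm_mul, norm_mul, norm_rayDir, Complex.norm_real, Real.norm_of_nonneg hδ0.le]
    conv_lhs => rw [← Complex.norm_mul_exp_arg_mul_I (deriv ζ 0)]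
    rw [rayDir, add_assoc (Complex.arg _), Complex.ofReal_add (Complex.arg _), add_mul,
      Complex.exp_add]
    push_cast
    ring

theorem IsArcStar.isArcFrom {S : Set ℂ} {z₀ : ℂ} {α : ℝ} (h : IsArcStar S z₀ 1 α) :
    IsArcFrom S z₀ := by
  obtain ⟨γ, h1, -, ⟨U, hU, hzU, hSU⟩, -⟩ := h
  refine ⟨γ 0, (h1 0).1, (h1 0).2, U, hU, hzU, ?_⟩
  rw [hSU]
  ext z
  rw [mem_iUnion]
  refine ⟨fun ⟨j, hj⟩ => ?_, fun hz => ⟨0, hz⟩⟩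
  rwa [Subsingleton.elim j 0] at hj

/-! ### The spectrum near a point -/

theorem add_mem_interval_iff_of_abs_lt {r : ℝ} {v : ℂ} (hv : ‖v‖ ≤ 1 - |r|) :
    (∃ r' : ℝ, -1 ≤ r' ∧ r' ≤ 1 ∧ (r : ℂ) + v = r') ↔ ∃ s : ℝ, v = s := by
  constructor
  · rintro ⟨r', -, -, h⟩
    exact ⟨r' - r, by push_cast; rw [← h]; ring⟩
  · rintro ⟨s, rfl⟩
    rw [Complex.norm_real, Real.norm_eq_abs] at hv
    have h1 := abs_le.1 ((abs_add_le r s).trans (by linarith : |r| + |s| ≤ 1))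
    exact ⟨r + s, h1.1, h1.2, by push_cast; rfl⟩

theorem add_mem_interval_iff_of_eq_one_or {r : ℝ} (hr : r = 1 ∨ r = -1) {v : ℂ} (hv : ‖v‖ ≤ 1) :
    (∃ r' : ℝ, -1 ≤ r' ∧ r' ≤ 1 ∧ (r : ℂ) + v = r') ↔ ∃ s : ℝ, 0 ≤ s ∧ (-r : ℂ) * v = s := by
  have hrr : (r : ℂ) * r = 1 := by rcases hr with rfl | rfl <;> norm_num
  constructor
  · rintro ⟨r', h1, h2, h⟩
    refine ⟨1 - r * r', ?_, ?_⟩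
    · rcases hr with rfl | rfl <;> linarith
    · push_cast
      rw [← h]
      linear_combination hrr
  · rintro ⟨s, hs, h⟩
    have hvs : v = ((-r * s : ℝ) : ℂ) := by
      push_cast
      rw [← h]
      linear_combination (-v) * hrr
    have hs1 : s ≤ 1 := by
      rw [hvs, Complex.norm_real, Real.norm_eq_abs] at hv
      rcases hr with rfl | rfl <;> simpa [abs_of_nonneg hs] using hv
    refine ⟨r - r * s, ?_, ?_, ?_⟩
    · rcases hr with rfl | rfl <;> linarith
    · rcases hr with rfl | rfl <;> linarith
    · rw [hvs]; push_cast; ring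

theorem exists_eq_ofReal_iff_sq (v : ℂ) :
    (∃ s : ℝ, v = s) ↔ ∃ s : ℝ, 0 ≤ s ∧ v ^ 2 = s := by
  constructor
  · rintro ⟨s, rfl⟩
    exact ⟨s ^ 2, sq_nonneg s, by push_cast; rfl⟩
  · rintro ⟨s, hs, h⟩
    have h1 : (v - √s) * (v + √s) = 0 := by
      have : ((√s : ℝ) : ℂ) ^ 2 = s := by exact_mod_cast Real.sq_sqrt hs
      linear_combination h - this
    rcases mul_eq_zero.1 h1 with h2 | h2
    · exact ⟨√s, sub_eq_zero.1 h2⟩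
    · exact ⟨-√s, by push_cast; exact eq_neg_of_add_eq_zero_left h2⟩

section Local

variable {V : ℝ → ℂ} {ω : ℝ} (hω : 0 < ω) (hV : LocallyIntegrable V)
  (hper : Function.Periodic V ω) {E₀ : ℂ} {k : ℕ} (hk : k ≠ 0)
  (h0 : ∀ j, 1 ≤ j → j < k → iteratedDeriv j (discriminant V ω) E₀ = 0)
  (h1 : iteratedDeriv k (discriminant V ω) E₀ ≠ 0)
include hω hV hper hk h0 h1

/-- In a chart in which the discriminant is `r + w ^ k`, the spectrum is determined by `w ^ k`. -/
theorem exists_chart_mem_spectrumSet_iff {r : ℝ} (hr : discriminant V ω E₀ = r) {m : ℝ}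
    (hm : 0 < m) : ∃ ε ζ, IsHolomorphicChart E₀ ε ζ ∧ ∃ δ, 0 < δ ∧ δ < ε ∧ ∀ w : ℂ, ‖w‖ < δ →
      ‖w ^ k‖ ≤ m ∧ (ζ w ∈ spectrumSet (hillOperator V) ↔
        ∃ r' : ℝ, -1 ≤ r' ∧ r' ≤ 1 ∧ (r : ℂ) + w ^ k = r') := by
  have ha : AnalyticAt ℂ (discriminant V ω) E₀ := (differentiable_discriminant hV ω).analyticAt E₀
  obtain ⟨ε, ζ, hζ, hw⟩ := exists_isHolomorphicChart_pow ha hk h0 h1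
  have hε := hζ.pos
  refine ⟨ε, ζ, hζ, min (ε / 2) (min 1 m), by positivity,
    (min_le_left _ _).trans_lt (by linarith), fun w hwδ => ⟨?_, ?_⟩⟩
  · have h2 : ‖w‖ < min 1 m := hwδ.trans_le (min_le_right _ _)
    rw [norm_pow]
    exact (pow_le_of_le_one (norm_nonneg _) (h2.trans_le (min_le_left _ _)).le hk).trans
      (h2.trans_le (min_le_right _ _)).le
  · have h2 : w ∈ Metric.ball (0 : ℂ) ε := by
      rw [mem_ball_zero_iff]
      have := hwδ.trans_le (min_le_left _ _)
      linarith
    rw [mem_spectrumSet_iff hω hV hper, hw w h2, hr]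

theorem isArcStar_of_abs_lt {r : ℝ} (hr : discriminant V ω E₀ = r) (hr1 : |r| < 1) :
    IsArcStar (spectrumSet (hillOperator V)) E₀ (2 * k) (Real.pi / k) := by
  obtain ⟨ε, ζ, hζ, δ, hδ0, hδ, hS⟩ :=
    exists_chart_mem_spectrumSet_iff hω hV hper hk h0 h1 hr (sub_pos.2 hr1)
  have h2 := hζ.isArcStar (n := 2 * k) (c := 1) (θ := 0) (by omega) (by simp) hδ0 hδ
    fun w hw => by
      rw [(hS w hw).2, add_mem_interval_iff_of_abs_lt (hS w hw).1, exists_eq_ofReal_iff_sq,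
        one_mul, ← pow_mul, mul_comm k]
  have e : 2 * Real.pi / ((2 * k : ℕ) : ℝ) = Real.pi / k := by
    push_cast
    rw [mul_div_mul_left _ _ two_ne_zero]
  rwa [e] at h2

theorem isArcStar_of_eq_one_or {r : ℝ} (hr : discriminant V ω E₀ = r) (hr1 : r = 1 ∨ r = -1) :
    IsArcStar (spectrumSet (hillOperator V)) E₀ k (2 * Real.pi / k) := by
  obtain ⟨ε, ζ, hζ, δ, hδ0, hδ, hS⟩ :=
    exists_chart_mem_spectrumSet_iff hω hV hper hk h0 h1 hr one_pos
  have hθ : ∃ θ : ℝ, (-r : ℂ) * Complex.exp (θ * Complex.I) ^ k = 1 := by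
    have hk' : (k : ℂ) ≠ 0 := by exact_mod_cast hk
    rcases hr1 with rfl | rfl
    · refine ⟨Real.pi / k, ?_⟩
      rw [← Complex.exp_nat_mul]
      push_cast
      rw [← mul_assoc, mul_div_cancel₀ _ hk', Complex.exp_pi_mul_I]
      norm_num
    · exact ⟨0, by simp⟩
  obtain ⟨θ, hθ⟩ := hθ
  exact hζ.isArcStar hk hθ hδ0 hδ fun w hw => by
    rw [(hS w hw).2, add_mem_interval_iff_of_eq_one_or hr1 (hS w hw).1]

end Local

theorem isArcThrough_of_abs_lt {V : ℝ → ℂ} {ω : ℝ} (hω : 0 < ω) (hV : LocallyIntegrable V)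
    (hper : Function.Periodic V ω) {E₀ : ℂ} (h1 : iteratedDeriv 1 (discriminant V ω) E₀ ≠ 0)
    {r : ℝ} (hr : discriminant V ω E₀ = r) (hr1 : |r| < 1) :
    IsArcThrough (spectrumSet (hillOperator V)) E₀ := by
  obtain ⟨ε, ζ, hζ, δ, hδ0, hδ, hS⟩ := exists_chart_mem_spectrumSet_iff hω hV hper one_ne_zero
    (fun j hj hj' => absurd hj (by omega)) h1 hr (sub_pos.2 hr1)
  exact hζ.isArcThrough hδ0 hδ fun w hw => by
    rw [(hS w hw).2, add_mem_interval_iff_of_abs_lt (hS w hw).1, pow_one]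

end Hill

end

theorem theorem1 (V : ℝ → ℂ) (ω : ℝ) (hω : 0 < ω)
    (hV : MeasureTheory.LocallyIntegrable V MeasureTheory.volume)
    (hper : Function.Periodic V ω) (E₀ : ℂ) :
    (deriv (Hill.discriminant V ω) E₀ ≠ 0 →
      ((∃ r : ℝ, -1 < r ∧ r < 1 ∧ Hill.discriminant V ω E₀ = r) →
        Hill.IsArcThrough (Hill.spectrumSet (Hill.hillOperator V)) E₀) ∧
      ((Hill.discriminant V ω E₀ = 1 ∨ Hill.discriminant V ω E₀ = -1) →
        Hill.IsArcFrom (Hill.spectrumSet (Hill.hillOperator V)) E₀)) ∧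
    (∀ k : ℕ, 2 ≤ k →
      (∀ j : ℕ, 1 ≤ j → j < k → iteratedDeriv j (Hill.discriminant V ω) E₀ = 0) →
      iteratedDeriv k (Hill.discriminant V ω) E₀ ≠ 0 →
      ((∃ r : ℝ, -1 < r ∧ r < 1 ∧ Hill.discriminant V ω E₀ = r) →
        Hill.IsArcStar (Hill.spectrumSet (Hill.hillOperator V)) E₀ (2 * k) (Real.pi / k)) ∧
      ((Hill.discriminant V ω E₀ = 1 ∨ Hill.discriminant V ω E₀ = -1) →
        Hill.IsArcStar (Hill.spectrumSet (Hill.hillOperator V)) E₀ k (2 * Real.pi / k))) := by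
  have hend : (Hill.discriminant V ω E₀ = 1 ∨ Hill.discriminant V ω E₀ = -1) →
      ∃ r : ℝ, Hill.discriminant V ω E₀ = r ∧ (r = 1 ∨ r = -1) := by
    rintro (h | h)
    · exact ⟨1, by rw [h]; norm_num, Or.inl rfl⟩
    · exact ⟨-1, by rw [h]; norm_num, Or.inr rfl⟩
  refine ⟨fun hd => ?_, fun k hk h0 h1 => ⟨?_, fun h => ?_⟩⟩
  · rw [← iteratedDeriv_one] at hd
    refine ⟨?_, fun h => ?_⟩
    · rintro ⟨r, hr1, hr2, hr⟩
      exact Hill.isArcThrough_of_abs_lt hω hV hper hd hr (abs_lt.2 ⟨hr1, hr2⟩)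
    · obtain ⟨r, hr, hr1⟩ := hend h
      exact (Hill.isArcStar_of_eq_one_or hω hV hper one_ne_zero
        (fun j hj hj' => absurd hj (by omega)) hd hr hr1).isArcFrom
  · rintro ⟨r, hr1, hr2, hr⟩
    exact Hill.isArcStar_of_abs_lt hω hV hper (by omega) h0 h1 hr (abs_lt.2 ⟨hr1, hr2⟩)
  · obtain ⟨r, hr, hr1⟩ := hend h
    exact Hill.isArcStar_of_eq_one_or hω hV hper (by omega) h0 h1 hr hr1
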